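/- **Setting.** Fix pairwise disjoint, countably infinite sets of constants, nulls, variables and predicates (each predicate with an arity). An *interpretation* is a set of variable-free atoms; a *database* $D$ is a finite interpretation without nulls, and $|D|$ is its number of atoms. A *tgd* is a formula $B[\vec x,\vec y]\to\exists\vec v.\,H[\vec y,\vec v]$ with $B,H$ finite conjunctions of null-free atoms, where $\vec x,\vec y$ are the variables of $B$, the *frontier* $\vec y$ consists of the variables occurring in both $B$ and $H$, and the existential variables $\vec v$ are those occurring in $H$ only; it is a *Datalog rule* if $\vec v$ is empty. Let $\Sigma$ be a finite set of tgds no two of which share a variable; $\rho_v\in\Sigma$ denotes the tgd of an existential variable $v$. A *match* of a tgd in $I$ is a substitution $\sigma$ of the body variables with $B\sigma\subseteq I$; it is *satisfied* in $I$ if it extends to $\sigma'$ with $H\sigma'\subseteq I$; a tgd is satisfied if all its matches are. **Chase.** A (standard, Datalog-first) chase sequence for $\Sigma,D$ is a finite or infinite sequence $D^0=D,D^1,\dots$ in which each step applies some tgd of $\Sigma$ to a match $\sigma$ that is unsatisfied in $D^i$, $D^{i+1}$ being $D^i$ together with the head instance in which the existential variables are replaced by distinct nulls not occurring in $D^i$;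 a tgd with existential variables is applied to $D^i$ only if $D^i$ satisfies all Datalog rules of $\Sigma$; and every match in some $D^i$ is satisfied in some $D^j$ with $j\ge i$. For a null $n$ created as value of the existential variable $v$ we write $\mathrm{var}(n)=v$. **Dependency graph.** For an existential variable $v$, $\Omega_v$ is the smallest set of predicate positions that contains all head positions of $v$ and that contains all head positions of a universal variable $x$ whenever it contains all body positions of $x$. The labelled graph $G(\Sigma)$ has the existential variables as vertices and an edge $v\to^{y}w$ whenever $y$ is a frontier variable of $\rho_w$ all of whose body positions lie in $\Omega_v$. Its strongly connected components are called components (single vertices included), $\mathrm{scc}(v)$ being the one of $v$. For components, $C'\prec C$ means that $C'\ne C$ and there is an edge from $C'$ to $C$. **Propagation.** For a non-empty path $p=v_0\to^{y_1}v_1\cdots\to^{y_k}v_k$ take variants $B_i\to\exists.H_i$ of $\rho_{v_i}$ ($1\le i\le k$) with pairwise disjoint variables, let $\tilde y_i,\tilde v_i$ be the copies of $y_i,v_i$, let $\tilde y_{k+1}$ be fresh, and put $\mathrm{Path}(p)=\bigwedge_{i=1}^k(B_i\wedge H_i[\tilde v_i/\tilde y_{i+1}])$. Entailment below is by the Datalog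 rules of $\Sigma$, over all interpretations. The path $p$ is *base-propagating* if $\mathrm{Path}(p)\to H'$ is entailed, where $H'$ is $H_1[\tilde v_1/\tilde y_2]$ with $\tilde y_1$ replaced by $\tilde y_{k+1}$. For an edge $e=u^*\to^{y^*}v^*$ write the head of $\rho_{v^*}$ as $H^*[y^*,\vec z,v^*,\vec w]$, where $\vec z$ lists the other frontier variables and $\vec w$ the other existential variables. A concatenation $p=p^ap^b$ of non-empty paths of lengths $\ell,k$ is *step-propagating* for $e$ if $\mathrm{Path}(p)\wedge H^*[\tilde y_{\ell+1},\vec x_z,\tilde y_2,\vec x_w]\to H^*[\tilde y_{\ell+k+1},\vec x_z,\tilde y_{\ell+2},\vec x_w]$ is entailed, with fresh variables $\vec x_z,\vec x_w$. **Saturation.** Let $C$ be a component and $E$ a set of edges in $C$. An $\bar E$-path is a possibly empty path in $C$ without edges of $E$ that starts in the target of an edge of $E$ and ends in the source of an edge of $E$. $C$ is *$E$-saturating* if (1) $C$ without the edges of $E$ is acyclic; (2) any $u\to^{x}v,\ u'\to^{x'}v\in E$ have $x=x'$; (3) all paths $ep$ in $C$ with $e\in E$ and $p$ an $\bar E$-path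 are base-propagating; (4) all paths $e^ap_1e^bp_2$ in $C$ with $e^a,e^b\in E$ and $p_1,p_2$ $\bar E$-paths are step-propagating (with parts $e^ap_1$ and $e^bp_2$) for every $e\in E$. $\Sigma$ is *saturating* if every component $C$ is $E_C$-saturating for some $E_C$; fix such sets $E_C$. **Rank.** The confluence of a vertex $v$ is the number of labels of edges into $v$ from $\mathrm{scc}(v)$, and $\mathrm{conf}(C)$ is the maximum over $v\in C$. A *context component* of $C$ is a component $C'$ for which there are $v,w\in C$, $u\in C'$, an edge $w\to^{x}v$ in $E_C$, and an edge $u\to^{y}v$ of $G(\Sigma)$ with $y\ne x$. Assume that no component is a context component of itself (so that the following recursion along $\prec$ is well-founded). Let $r_{\mathrm{in}}$ be the maximal rank of the components $C'\prec C$ and $r_{\mathrm{cxt}}$ the maximal rank of the context components of $C$ (with $\max\emptyset=0$). Then $$\mathrm{rank}(C)=\begin{cases}r_{\mathrm{in}}&\text{if }\mathrm{conf}(C)=0,\\ \max\{r_{\mathrm{in}},r_{\mathrm{cxt}}+1\}&\text{if }\mathrm{conf}(C)=1,\\ \max\{r_{\mathrm{in}},r_{\mathrm{cxt}}+2\}&\text{if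 }\mathrm{conf}(C)\ge2.\end{cases}$$ A function $f:\mathbb N\to\mathbb N$ is *$\kappa$-exponential* if $f(n)\le\exp_\kappa(q(n))$ for some polynomial $q$, where $\exp_0(m)=m$ and $\exp_{\kappa+1}(m)=2^{\exp_\kappa(m)}$. **Theorem.** Let $\Sigma$ be saturating, with sets $E_C$ as above, and let $v$ be an existential variable of $\Sigma$. Then there is a $\mathrm{rank}(\mathrm{scc}(v))$-exponential function $f$ such that for every database $D$ and every chase sequence for $\Sigma$ and $D$, the number of nulls $n$ with $\mathrm{var}(n)=v$ is finite and at most $f(|D|)$. -/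

import Mathlib

/-- A relational signature: pairwise disjoint, countably infinite sets of constants, nulls, variables
and predicates, where every predicate has an arity. -/
structure Signature where
  Con : Type
  Null : Type
  Var : Type
  Pred : Type
  arity : Pred → ℕ
  con_denum : Nonempty (Con ≃ ℕ)
  null_denum : Nonempty (Null ≃ ℕ)
  var_denum : Nonempty (Var ≃ ℕ)
  pred_denum : Nonempty (Pred ≃ ℕ)

namespace Chase

/-- Atoms `p(t₁, …, tₙ)` with terms in `T`. -/
structure Atom (S : Signature) (T : Type) where
  pred : S.Pred
  args : Fin (S.arity pred) → T

/-- Apply a map to all terms of an atom. -/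
def Atom.map {S : Signature} {T T' : Type} (f : T → T') (a : Atom S T) : Atom S T' :=
  ⟨a.pred, fun i => f (a.args i)⟩

/-- Variable-free terms: constants and nulls. -/
inductive GTerm (S : Signature) : Type
  | con (c : S.Con)
  | null (n : S.Null)

/-- Null-free terms with variables from `X`, as they occur in rules. -/
inductive RTerm (S : Signature) (X : Type) : Type
  | con (c : S.Con)
  | var (x : X)

/-- Replace variables by terms (of either kind), constants being mapped by `c`. -/
def RTerm.elim {S : Signature} {X T : Type} (c : S.Con → T) (σ : X → T) : RTerm S X → T
  | .con a => c a
  | .var x => σ x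

/-- The variable-free atom `aσ`. -/
def Atom.subst {S : Signature} {X : Type} (σ : X → GTerm S) (a : Atom S (RTerm S X)) :
    Atom S (GTerm S) :=
  a.map (RTerm.elim GTerm.con σ)

/-- Renaming of the variables of an atom. -/
def Atom.rename {S : Signature} {X Y : Type} (ρ : X → Y) (a : Atom S (RTerm S X)) :
    Atom S (RTerm S Y) :=
  a.map (RTerm.elim RTerm.con (fun x => RTerm.var (ρ x)))

/-- Interpretations: sets of variable-free atoms. -/
abbrev Interp (S : Signature) : Type := Set (Atom S (GTerm S))

/-- Databases: finite sets of variable-free and null-free atoms. -/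
abbrev Database (S : Signature) : Type := Finset (Atom S S.Con)

/-- A database as an interpretation. -/
def Database.toInterp {S : Signature} (D : Database S) : Interp S :=
  {a | ∃ b ∈ D, a = b.map GTerm.con}

/-- The null `n` occurs in the interpretation `I`. -/
def OccursIn {S : Signature} (n : S.Null) (I : Interp S) : Prop :=
  ∃ a ∈ I, ∃ i, a.args i = GTerm.null n

/-- Conjunctions of null-free atoms with variables in `X`. -/
abbrev Conj (S : Signature) (X : Type) : Type := List (Atom S (RTerm S X))

/-- The variables that occur in a conjunction. -/
def Conj.vars {S : Signature} {X : Type} (A : Conj S X) : Set X :=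
  {x | ∃ a ∈ A, ∃ i, a.args i = RTerm.var x}

/-- `Aσ ⊆ I`. -/
def Conj.HoldsIn {S : Signature} {X : Type} (A : Conj S X) (σ : X → GTerm S) (I : Interp S) :
    Prop :=
  ∀ a ∈ A, a.subst σ ∈ I

/-- A tuple-generating dependency `body → ∃ v. head`. The universally quantified variables are those
of the body, the existentially quantified ones are those that occur in the head only. -/
structure TGD (S : Signature) (X : Type) where
  body : Conj S X
  head : Conj S X

namespace TGD
variable {S : Signature} {X : Type}

def exVars (r : TGD S X) : Set X := {x | x ∈ r.head.vars ∧ x ∉ r.body.vars}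

def frontier (r : TGD S X) : Set X := {x | x ∈ r.head.vars ∧ x ∈ r.body.vars}

def vars (r : TGD S X) : Set X := {x | x ∈ r.head.vars ∨ x ∈ r.body.vars}

def IsDatalog (r : TGD S X) : Prop := r.exVars = ∅

/-- `σ` is a match of `r` in `I` (only its values on the body variables matter). -/
def IsMatch (r : TGD S X) (σ : X → GTerm S) (I : Interp S) : Prop := r.body.HoldsIn σ I

/-- The match `σ` of `r` is satisfied in `I`: it extends to the existential variables in such a way
that the head holds. -/
def SatMatch (r : TGD S X) (σ : X → GTerm S) (I : Interp S) : Prop :=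
  ∃ σ' : X → GTerm S, (∀ x ∈ r.body.vars, σ' x = σ x) ∧ r.head.HoldsIn σ' I

/-- `I ⊨ r`. -/
def SatisfiedBy (r : TGD S X) (I : Interp S) : Prop :=
  ∀ σ : X → GTerm S, r.IsMatch σ I → r.SatMatch σ I

end TGD

/-- Finite sets of tgds. -/
abbrev TGDSet (S : Signature) : Type := Finset (TGD S S.Var)

/-- Distinct tgds do not share variables. -/
def RenamedApart {S : Signature} (T : TGDSet S) : Prop :=
  ∀ r ∈ T, ∀ r' ∈ T, r ≠ r' → Disjoint r.vars r'.vars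

/-- The Datalog rules of `T` entail the tgd `r` (which may use variables of another kind). -/
def DatalogEntails {S : Signature} {Y : Type} (T : TGDSet S) (r : TGD S Y) : Prop :=
  ∀ I : Interp S, (∀ d ∈ T, d.IsDatalog → d.SatisfiedBy I) → r.SatisfiedBy I

/-- Chase sequences of the standard chase with the Datalog-first strategy. The sequence
`inst 0, inst 1, …` consists of `len` steps, possibly infinitely many; `rule i` is the tgd applied in
step `i` and `sub i` is the extended match, i.e. the match on the body variables together with the
fresh nulls for the existential variables. Values beyond `len` are irrelevant. -/
structure ChaseSequence {S : Signature} (T : TGDSet S) (D : Database S) where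
  len : ℕ∞
  inst : ℕ → Interp S
  rule : ℕ → TGD S S.Var
  sub : ℕ → S.Var → GTerm S
  init : inst 0 = D.toInterp
  rule_mem : ∀ i : ℕ, (i : ℕ∞) < len → rule i ∈ T
  isMatch : ∀ i : ℕ, (i : ℕ∞) < len → (rule i).IsMatch (sub i) (inst i)
  unsatisfied : ∀ i : ℕ, (i : ℕ∞) < len → ¬ (rule i).SatMatch (sub i) (inst i)
  fresh : ∀ i : ℕ, (i : ℕ∞) < len → ∀ v ∈ (rule i).exVars,
    ∃ n : S.Null, sub i v = GTerm.null n ∧ ¬ OccursIn n (inst i)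
  distinct : ∀ i : ℕ, (i : ℕ∞) < len → Set.InjOn (sub i) (rule i).exVars
  step : ∀ i : ℕ, (i : ℕ∞) < len →
    inst (i + 1) = inst i ∪ {a | ∃ b ∈ (rule i).head, a = b.subst (sub i)}
  datalog_first : ∀ i : ℕ, (i : ℕ∞) < len → ¬ (rule i).IsDatalog →
    ∀ d ∈ T, d.IsDatalog → d.SatisfiedBy (inst i)
  fair : ∀ i : ℕ, (i : ℕ∞) ≤ len → ∀ r ∈ T, ∀ σ : S.Var → GTerm S, r.IsMatch σ (inst i) →
    ∃ j : ℕ, i ≤ j ∧ (j : ℕ∞) ≤ len ∧ r.SatMatch σ (inst j)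

/-- The nulls that the chase introduces as values of the existential variable `v`. -/
def ChaseSequence.nullsOf {S : Signature} {T : TGDSet S} {D : Database S} (ch : ChaseSequence T D)
    (v : S.Var) : Set S.Null :=
  {n | ∃ i : ℕ, (i : ℕ∞) < ch.len ∧ v ∈ (ch.rule i).exVars ∧ ch.sub i v = GTerm.null n}

section Graph
variable {S : Signature}

/-- Predicate positions. -/
abbrev Position (S : Signature) : Type := (p : S.Pred) × Fin (S.arity p)

/-- The positions at which `x` occurs in the conjunction `A`. -/
def Conj.positions (A : Conj S S.Var) (x : S.Var) : Set (Position S) :=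
  {q | ∃ a ∈ A, ∃ i, a.args i = RTerm.var x ∧ q = ⟨a.pred, i⟩}

/-- The body positions of `x` in its tgd. -/
def posBody (T : TGDSet S) (x : S.Var) : Set (Position S) := {q | ∃ r ∈ T, q ∈ r.body.positions x}

/-- The head positions of `x` in its tgd. -/
def posHead (T : TGDSet S) (x : S.Var) : Set (Position S) := {q | ∃ r ∈ T, q ∈ r.head.positions x}

def univVars (T : TGDSet S) : Set S.Var := {x | ∃ r ∈ T, x ∈ r.body.vars}

def exVars (T : TGDSet S) : Set S.Var := {v | ∃ r ∈ T, v ∈ r.exVars}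

/-- The smallest set of positions that contains the head positions of `v`, and that contains the head
positions of a universal variable whenever it contains all of its body positions. -/
def Omega (T : TGDSet S) (v : S.Var) : Set (Position S) :=
  ⋂₀ {O | posHead T v ⊆ O ∧ ∀ x ∈ univVars T, posBody T x ⊆ O → posHead T x ⊆ O}

/-- A labelled edge from `src` to `tgt`. -/
structure Edge (S : Signature) where
  src : S.Var
  lbl : S.Var
  tgt : S.Var

/-- The edges of the labelled existential dependency graph of `T`, whose set of vertices is
`exVars T`. -/
def IsEdge (T : TGDSet S) (e : Edge S) : Prop :=
  e.src ∈ exVars T ∧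
    ∃ r ∈ T, e.tgt ∈ r.exVars ∧ e.lbl ∈ r.frontier ∧ posBody T e.lbl ⊆ Omega T e.src

/-- `p` is a (possibly empty) path from `u` to `w` that uses only edges in `G`. -/
def IsPath (G : Set (Edge S)) : S.Var → List (Edge S) → S.Var → Prop
  | u, [], w => u = w
  | u, e :: p, w => e ∈ G ∧ e.src = u ∧ IsPath G e.tgt p w

/-- `w` is reachable from `u` by a possibly empty path. -/
def Reach (T : TGDSet S) (u w : S.Var) : Prop := ∃ p, IsPath {e | IsEdge T e} u p w

/-- The strongly connected component of `v`. -/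
def scc (T : TGDSet S) (v : S.Var) : Set S.Var := {w | w ∈ exVars T ∧ Reach T v w ∧ Reach T w v}

def sccs (T : TGDSet S) : Set (Set S.Var) := {C | ∃ v ∈ exVars T, C = scc T v}

/-- The edges in the component `C`. -/
def edgesIn (T : TGDSet S) (C : Set S.Var) : Set (Edge S) :=
  {e | IsEdge T e ∧ e.src ∈ C ∧ e.tgt ∈ C}

/-- Variables of path queries: the copy of `x` in the `i`-th tgd variant of the path, the variable for
the end of the path, and further fresh variables. -/
inductive PVar (S : Signature) : Type
  | copy (i : ℕ) (x : S.Var)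
  | last
  | fresh (x : S.Var)

open Classical in
/-- The tgd of the existential variable `v` (it is unique if `T` is renamed apart). -/
noncomputable def tgdOf (T : TGDSet S) (v : S.Var) : TGD S S.Var :=
  if h : ∃ r ∈ T, v ∈ r.exVars then h.choose else ⟨[], []⟩

/-- For a path with edges `p 0, …, p (k-1)`, the variable for its `i`-th vertex (`0 ≤ i ≤ k`): for
`i < k` the copy of the label of `p i` in the `i`-th tgd variant, and a fresh variable for `i = k`. -/
def joint (p : List (Edge S)) (i : ℕ) : PVar S :=
  match p[i]? with
  | some e => PVar.copy i e.lbl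
  | none => PVar.last

open Classical in
/-- The `i`-th head conjunction of the path query (`e = p i`): the variable of `e.tgt` is identified
with the label of the next edge. -/
noncomputable def pathHead (T : TGDSet S) (p : List (Edge S)) (i : ℕ) (e : Edge S) :
    Conj S (PVar S) :=
  (tgdOf T e.tgt).head.map (Atom.rename fun x => if x = e.tgt then joint p (i + 1) else .copy i x)

/-- The `i`-th body conjunction of the path query (`e = p i`). -/
noncomputable def pathBody (T : TGDSet S) (i : ℕ) (e : Edge S) : Conj S (PVar S) :=
  (tgdOf T e.tgt).body.map (Atom.rename fun x => .copy i x)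

/-- The path query `Path(p)`. -/
noncomputable def pathQuery (T : TGDSet S) (p : List (Edge S)) : Conj S (PVar S) :=
  p.zipIdx.flatMap fun ei => pathBody T ei.2 ei.1 ++ pathHead T p ei.2 ei.1

open Classical in
/-- The head of the tgd of `e.tgt` with the frontier variable `e.lbl` replaced by `a`, the existential
variable `e.tgt` replaced by `b`, and any other variable `x` replaced by `ρ x`. -/
noncomputable def headInst (T : TGDSet S) (e : Edge S) (a b : PVar S) (ρ : S.Var → PVar S) :
    Conj S (PVar S) :=
  (tgdOf T e.tgt).head.map
    (Atom.rename fun x => if x = e.lbl then a else if x = e.tgt then b else ρ x)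

/-- The path `e p` is base-propagating. -/
def BasePropagating (T : TGDSet S) (e : Edge S) (p : List (Edge S)) : Prop :=
  DatalogEntails T
    ⟨pathQuery T (e :: p),
      headInst T e (joint (e :: p) (p.length + 1)) (joint (e :: p) 1) (.copy 0)⟩

/-- The composite path `pa pb` (with non-empty parts) is step-propagating for `e`. -/
def StepPropagating (T : TGDSet S) (pa pb : List (Edge S)) (e : Edge S) : Prop :=
  DatalogEntails T
    ⟨pathQuery T (pa ++ pb) ++
        headInst T e (joint (pa ++ pb) pa.length) (joint (pa ++ pb) 1) .fresh,
      headInst T e (joint (pa ++ pb) (pa.length + pb.length)) (joint (pa ++ pb) (pa.length + 1))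
        .fresh⟩

/-- `p` is a path from `s` to `t` in `C` without edges of `E` that starts in the target and ends in
the source of some edges of `E`. -/
def IsEBarPath (T : TGDSet S) (C : Set S.Var) (E : Set (Edge S)) (s : S.Var) (p : List (Edge S))
    (t : S.Var) : Prop :=
  IsPath (edgesIn T C \ E) s p t ∧ (∃ e ∈ E, e.tgt = s) ∧ (∃ e ∈ E, e.src = t)

/-- The component `C` is `E`-saturating. -/
structure IsSaturating (T : TGDSet S) (C : Set S.Var) (E : Set (Edge S)) : Prop where
  edges : E ⊆ edgesIn T C
  acyclic : ∀ u p, IsPath (edgesIn T C \ E) u p u → p = []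
  same_label : ∀ e ∈ E, ∀ e' ∈ E, e.tgt = e'.tgt → e.lbl = e'.lbl
  base : ∀ e ∈ E, ∀ p t, IsEBarPath T C E e.tgt p t → BasePropagating T e p
  step : ∀ ea ∈ E, ∀ eb ∈ E, ∀ p₁ p₂ t, IsEBarPath T C E ea.tgt p₁ eb.src →
    IsEBarPath T C E eb.tgt p₂ t → ∀ e ∈ E, StepPropagating T (ea :: p₁) (eb :: p₂) e

/-- The confluence of a vertex: the number of labels of its incoming edges from its component. -/
noncomputable def confluence (T : TGDSet S) (v : S.Var) : ℕ :=
  {x | ∃ u ∈ scc T v, IsEdge T ⟨u, x, v⟩}.ncard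

/-- The confluence of a component: the maximal confluence of its vertices. -/
noncomputable def confluenceOf (T : TGDSet S) (C : Set S.Var) : ℕ :=
  sSup {k | ∃ v ∈ C, k = confluence T v}

/-- The component `C'` is a direct predecessor of the component `C`: some edge from `C'` is incoming
for `C`. -/
def Prec (T : TGDSet S) (C' C : Set S.Var) : Prop :=
  C' ∈ sccs T ∧ C ∈ sccs T ∧ C' ≠ C ∧ ∃ u ∈ C', ∃ w ∈ C, ∃ y, IsEdge T ⟨u, y, w⟩

/-- The context components of `C`, for the chosen edge sets `E`. -/
def contextComponents (T : TGDSet S) (E : Set S.Var → Set (Edge S)) (C : Set S.Var) :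
    Set (Set S.Var) :=
  {C' | C' ∈ sccs T ∧ ∃ v ∈ C, ∃ w ∈ C, ∃ u ∈ C', ∃ x y,
    (⟨w, x, v⟩ : Edge S) ∈ E C ∧ IsEdge T ⟨u, y, v⟩ ∧ x ≠ y}

theorem finite_exVars (T : TGDSet S) : (exVars T).Finite := by
  have h : exVars T ⊆ ⋃ r ∈ (T : Set (TGD S S.Var)), ⋃ a ∈ {a | a ∈ r.head},
      ⋃ i, {x | a.args i = RTerm.var x} := by
    rintro v ⟨r, hr, ⟨a, ha, i, hi⟩, -⟩
    simp only [Set.mem_iUnion]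
    exact ⟨r, hr, a, ha, i, hi⟩
  refine Set.Finite.subset ?_ h
  refine T.finite_toSet.biUnion fun r _ => (List.finite_toSet r.head).biUnion fun a _ => ?_
  refine Set.finite_iUnion fun i => Set.Subsingleton.finite ?_
  intro x hx y hy
  have := hx.symm.trans hy
  simpa using this

theorem IsPath.append {G : Set (Edge S)} {p q : List (Edge S)} {u v w : S.Var}
    (hp : IsPath G u p v) (hq : IsPath G v q w) : IsPath G u (p ++ q) w := by
  induction p generalizing u with
  | nil => cases hp; exact hq
  | cons e p ih => exact ⟨hp.1, hp.2.1, ih hp.2.2⟩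

theorem Reach.trans {T : TGDSet S} {u v w : S.Var} (h : Reach T u v) (h' : Reach T v w) :
    Reach T u w := by
  obtain ⟨p, hp⟩ := h
  obtain ⟨q, hq⟩ := h'
  exact ⟨p ++ q, hp.append hq⟩

theorem prec_wf (T : TGDSet S) : WellFounded (Prec T) := by
  have key : ∀ C' C, Prec T C' C →
      {u | u ∈ exVars T ∧ ∃ w ∈ C', Reach T u w}.ncard <
        {u | u ∈ exVars T ∧ ∃ w ∈ C, Reach T u w}.ncard := by
    rintro C' C ⟨⟨a, ha, rfl⟩, ⟨b, hb, rfl⟩, hne, u, hu, w, hw, y, he⟩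
    have huw : Reach T u w := ⟨[⟨u, y, w⟩], he, rfl, rfl⟩
    refine Set.ncard_lt_ncard ?_ ((finite_exVars T).subset fun _ h => h.1)
    refine (Set.ssubset_iff_of_subset ?_).2 ⟨w, ⟨hw.1, w, hw, [], rfl⟩, ?_⟩
    · rintro x ⟨hx, z, hz, hxz⟩
      exact ⟨hx, w, hw, ((hxz.trans hz.2.2).trans hu.2.1).trans huw⟩
    · rintro ⟨-, z, hz, hwz⟩
      have hab : Reach T a b := (hu.2.1.trans huw).trans hw.2.2
      have hba : Reach T b a := (hw.2.1.trans hwz).trans hz.2.2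
      apply hne
      ext x
      exact ⟨fun h => ⟨h.1, hba.trans h.2.1, h.2.2.trans hab⟩,
        fun h => ⟨h.1, hab.trans h.2.1, h.2.2.trans hba⟩⟩
  exact Subrelation.wf (fun {a b} h => key a b h)
    (measure fun C : Set S.Var => {u | u ∈ exVars T ∧ ∃ w ∈ C, Reach T u w}.ncard).wf

/-- The rank of a component from its confluence and the maximal ranks of its direct predecessors and
of its context components. -/
def rankStep (conf rin rcxt : ℕ) : ℕ :=
  match conf with
  | 0 => rin
  | 1 => max rin (rcxt + 1)
  | _ + 2 => max rin (rcxt + 2)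

/-- The rank of a component, by recursion along the order of the components. The suprema are maxima
of finite sets, where `max ∅ = 0`. See `rank_eq` for the recursive equation. -/
noncomputable def rank (T : TGDSet S) (E : Set S.Var → Set (Edge S)) : Set S.Var → ℕ :=
  (prec_wf T).fix fun C ih =>
    rankStep (confluenceOf T C)
      (sSup {k | ∃ (C' : Set S.Var) (h : Prec T C' C), k = ih C' h})
      (sSup {k | ∃ (C' : Set S.Var) (h : Prec T C' C), C' ∈ contextComponents T E C ∧ k = ih C' h})

/-- The recursive equation of the rank, for a component that is not one of its own context
components. -/
theorem rank_eq (T : TGDSet S) (E : Set S.Var → Set (Edge S)) (C : Set S.Var) (hC : C ∈ sccs T)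
    (h : C ∉ contextComponents T E C) :
    rank T E C = rankStep (confluenceOf T C) (sSup {k | ∃ C', Prec T C' C ∧ k = rank T E C'})
      (sSup {k | ∃ C' ∈ contextComponents T E C, k = rank T E C'}) := by
  have h1 : ∀ C' ∈ contextComponents T E C, Prec T C' C := by
    intro C' hC'
    have hne : C' ≠ C := by rintro rfl; exact h hC'
    obtain ⟨hs, v, hv, w, hw, u, hu, x, y, -, he, -⟩ := hC'
    exact ⟨hs, hC, hne, u, hu, v, hv, y, he⟩
  rw [rank, WellFounded.fix_eq]
  congr 2
  · ext k; simp
  · ext k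
    constructor
    · rintro ⟨C', -, h2, rfl⟩; exact ⟨C', h2, rfl⟩
    · rintro ⟨C', h2, rfl⟩; exact ⟨C', h1 C' h2, h2, rfl⟩

end Graph

/-- Iterated exponentials: `tower 0 m = m` and `tower (k + 1) m = 2 ^ tower k m`. -/
def tower : ℕ → ℕ → ℕ
  | 0, m => m
  | k + 1, m => 2 ^ tower k m

/-- `f` is (at most) `k`-exponential: bounded by the `k`-fold exponential of a polynomial. -/
def IsKExponential (k : ℕ) (f : ℕ → ℕ) : Prop :=
  ∃ p : Polynomial ℕ, ∀ n, f n ≤ tower k (p.eval n)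

end Chase

/-! Nulls are counted component by component, along the well-founded order of the components. For a
component C two things matter: how long a chain of nulls of C can be, where each null is a frontier
value in the step that introduces the next one, and how many nulls there are of a given depth.

Saturation bounds the length. Let an edge of E occur in a chain. Base-propagation makes the head of
its tgd hold again for the source of the next E-edge; step-propagation carries this instance on from
one E-edge to the next, with the target of the E-edge just passed as existential value and with the
original values of all other head variables (`exists_headHolds`). Datalog-first application ensures
that the entailed atoms are present before the next null is introduced. If the same edge came back
with the same values of its other frontier variables (its context), its match would already be
satisfied and the standard chase would not apply it (`not_repeated`). So a chain never repeats an
E-edge together with its context, and between E-edges it follows an acyclic graph. Its length is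
therefore polynomial in the number of possible context values (`length_le`). These are constants and
nulls of context components, never nulls of C, so the depth is exponential of height r_cxt.

For the number at a given depth, a null is determined by its variable and the frontier values of its
step (`eq_of_frontier_eq`). At most c = conf(C) of these values are nulls of C, of smaller depth;
all others are among K constants and nulls of preceding components, where K is bounded with height
r_in. This gives N(d+1) ≤ M (K + N(d))^c K^F (`level_succ_bound`), which is bounded independently of
d for c = 0, singly exponential in d for c = 1, and doubly exponential for c ≥ 2. These are the
three cases of the rank. -/

namespace Chase

/-! ### Substitutions, components and finiteness of the dependency graph -/

section Basics
variable {S : Signature} {X Y : Type}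

theorem Atom.subst_congr {σ τ : X → GTerm S} {a : Atom S (RTerm S X)}
    (h : ∀ i x, a.args i = RTerm.var x → σ x = τ x) : a.subst σ = a.subst τ := by
  unfold Atom.subst Atom.map
  congr 1
  funext i
  cases hi : a.args i with
  | con c => rfl
  | var x => exact h i x hi

theorem Atom.subst_rename (ρ : X → Y) (σ : Y → GTerm S) (a : Atom S (RTerm S X)) :
    (a.rename ρ).subst σ = a.subst (fun x => σ (ρ x)) := by
  unfold Atom.subst Atom.rename Atom.map
  congr 1
  funext i
  change RTerm.elim _ σ (RTerm.elim _ _ (a.args i)) = _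
  cases a.args i <;> rfl

theorem Conj.HoldsIn.congr {A : Conj S X} {σ τ : X → GTerm S} {I : Interp S}
    (h : A.HoldsIn σ I) (hστ : ∀ x ∈ A.vars, σ x = τ x) : A.HoldsIn τ I := by
  intro a ha
  rw [← Atom.subst_congr fun i x hx => hστ x ⟨a, ha, i, hx⟩]
  exact h a ha

theorem Conj.HoldsIn.mono {A : Conj S X} {σ : X → GTerm S} {I J : Interp S}
    (h : A.HoldsIn σ I) (hIJ : I ⊆ J) : A.HoldsIn σ J :=
  fun a ha => hIJ (h a ha)

theorem Conj.holdsIn_map_rename {A : Conj S X} {ρ : X → Y} {σ : Y → GTerm S} {I : Interp S} :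
    Conj.HoldsIn (A.map (Atom.rename ρ)) σ I ↔ A.HoldsIn (fun x => σ (ρ x)) I := by
  simp [Conj.HoldsIn, Atom.subst_rename]

theorem Conj.mem_vars_map_rename {A : Conj S X} {x : X} (ρ : X → Y) (h : x ∈ A.vars) :
    ρ x ∈ Conj.vars (S := S) (A.map (Atom.rename ρ)) := by
  obtain ⟨a, ha, i, hi⟩ := h
  refine ⟨a.rename ρ, List.mem_map_of_mem ha, i, ?_⟩
  simp [Atom.rename, Atom.map, hi, RTerm.elim]

theorem RenamedApart.eq {T : TGDSet S} (hT : RenamedApart T) {r r' : TGD S S.Var} (hr : r ∈ T)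
    (hr' : r' ∈ T) {x : S.Var} (h : x ∈ r.vars) (h' : x ∈ r'.vars) : r = r' := by
  by_contra hne
  exact Set.disjoint_left.1 (hT r hr r' hr' hne) h h'

theorem tgdOf_eq {T : TGDSet S} (hT : RenamedApart T) {r : TGD S S.Var} (hr : r ∈ T) {v : S.Var}
    (hv : v ∈ r.exVars) : tgdOf T v = r := by
  have h : ∃ r ∈ T, v ∈ r.exVars := ⟨r, hr, hv⟩
  rw [tgdOf, dif_pos h]
  exact hT.eq h.choose_spec.1 hr (Or.inl h.choose_spec.2.1) (Or.inl hv.1)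

theorem Reach.refl (T : TGDSet S) (u : S.Var) : Reach T u u := ⟨[], rfl⟩

theorem mem_scc_self {T : TGDSet S} {v : S.Var} (hv : v ∈ exVars T) : v ∈ scc T v :=
  ⟨hv, Reach.refl T v, Reach.refl T v⟩

theorem scc_eq_of_mem {T : TGDSet S} {u v : S.Var} (h : u ∈ scc T v) : scc T u = scc T v := by
  ext x
  exact ⟨fun hx => ⟨hx.1, h.2.1.trans hx.2.1, hx.2.2.trans h.2.2⟩,
    fun hx => ⟨hx.1, h.2.2.trans hx.2.1, hx.2.2.trans h.2.1⟩⟩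

theorem eq_scc_of_mem {T : TGDSet S} {C : Set S.Var} (hC : C ∈ sccs T) {v : S.Var} (hv : v ∈ C) :
    C = scc T v := by
  obtain ⟨w, -, rfl⟩ := hC
  exact (scc_eq_of_mem hv).symm

theorem subset_exVars_of_mem_sccs {T : TGDSet S} {C : Set S.Var} (hC : C ∈ sccs T) :
    C ⊆ exVars T := by
  obtain ⟨w, -, rfl⟩ := hC
  exact fun x hx => hx.1

theorem finite_sccs (T : TGDSet S) : (sccs T).Finite := by
  refine ((finite_exVars T).image (scc T)).subset ?_
  rintro C ⟨v, hv, rfl⟩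
  exact ⟨v, hv, rfl⟩

theorem posHead_subset_Omega (T : TGDSet S) (v : S.Var) : posHead T v ⊆ Omega T v :=
  fun _ hq _ hO => hO.1 hq

theorem posHead_subset_Omega_of_posBody {T : TGDSet S} {v x : S.Var} (hx : x ∈ univVars T)
    (h : posBody T x ⊆ Omega T v) : posHead T x ⊆ Omega T v :=
  fun _ hq O hO => hO.2 x hx (fun _ hp => h hp O hO) hq

/-- The frontier variables of the tgds in `T`. -/
def frontierVars (T : TGDSet S) : Set S.Var := {x | ∃ r ∈ T, x ∈ r.frontier}

theorem finite_vars_conj (A : Conj S X) : A.vars.Finite := by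
  have h : A.vars ⊆ ⋃ a ∈ {a | a ∈ A}, ⋃ i, {x | a.args i = RTerm.var x} := by
    rintro v ⟨a, ha, i, hi⟩
    simp only [Set.mem_iUnion]
    exact ⟨a, ha, i, hi⟩
  refine Set.Finite.subset ((List.finite_toSet A).biUnion fun a _ => ?_) h
  refine Set.finite_iUnion fun i => Set.Subsingleton.finite ?_
  intro x hx y hy
  simpa using hx.symm.trans hy

theorem finite_frontierVars (T : TGDSet S) : (frontierVars T).Finite := by
  have h : frontierVars T ⊆ ⋃ r ∈ (T : Set (TGD S S.Var)), r.head.vars := by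
    rintro v ⟨r, hr, hv⟩
    simp only [Set.mem_iUnion]
    exact ⟨r, hr, hv.1⟩
  exact (T.finite_toSet.biUnion fun r _ => finite_vars_conj r.head).subset h

theorem finite_isEdge (T : TGDSet S) : {e | IsEdge T e}.Finite := by
  have : {e | IsEdge T e} ⊆
      (fun t : S.Var × S.Var × S.Var => (⟨t.1, t.2.1, t.2.2⟩ : Edge S)) ''
        (exVars T ×ˢ (frontierVars T ×ˢ exVars T)) := by
    rintro ⟨u, x, v⟩ ⟨hu, r, hr, hv, hx, -⟩
    exact ⟨(u, x, v), ⟨hu, ⟨r, hr, hx⟩, r, hr, hv⟩, rfl⟩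
  exact (((finite_exVars T).prod ((finite_frontierVars T).prod (finite_exVars T))).image _).subset
    this

end Basics

/-! ### Origin of the terms in a chase: constants, nulls and dependency edges -/

/-- The constants that occur in the database atoms with body predicates, or in heads of tgds. -/
def relevantConstants {S : Signature} (T : TGDSet S) (D : Database S) : Set S.Con :=
  {c | ∃ a ∈ D, (∃ r ∈ T, ∃ b ∈ r.body, b.pred = a.pred) ∧ ∃ i, a.args i = c} ∪
    {c | ∃ r ∈ T, ∃ b ∈ r.head, ∃ i, b.args i = RTerm.con c}

namespace ChaseSequence
variable {S : Signature} {T : TGDSet S} {D : Database S}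

/-- In step `i` the null `n` is introduced as the value of the existential variable `v`. -/
def Creates (ch : ChaseSequence T D) (i : ℕ) (v : S.Var) (n : S.Null) : Prop :=
  (i : ℕ∞) < ch.len ∧ v ∈ (ch.rule i).exVars ∧ ch.sub i v = GTerm.null n

variable {ch : ChaseSequence T D}

theorem Creates.lt_len {i : ℕ} {v : S.Var} {n : S.Null} (h : ch.Creates i v n) :
    (i : ℕ∞) < ch.len := h.1

theorem Creates.mem_exVars {i : ℕ} {v : S.Var} {n : S.Null} (h : ch.Creates i v n) :
    v ∈ (ch.rule i).exVars := h.2.1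

theorem Creates.sub_eq {i : ℕ} {v : S.Var} {n : S.Null} (h : ch.Creates i v n) :
    ch.sub i v = GTerm.null n := h.2.2

theorem Creates.rule_mem {i : ℕ} {v : S.Var} {n : S.Null} (h : ch.Creates i v n) :
    ch.rule i ∈ T := ch.rule_mem i h.1

theorem Creates.tgdOf_eq (hT : RenamedApart T) {i : ℕ} {v : S.Var} {n : S.Null}
    (h : ch.Creates i v n) : tgdOf T v = ch.rule i :=
  Chase.tgdOf_eq hT h.rule_mem h.mem_exVars

theorem Creates.exVars_mem {i : ℕ} {v : S.Var} {n : S.Null} (h : ch.Creates i v n) :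
    v ∈ exVars T := ⟨_, h.rule_mem, h.mem_exVars⟩

theorem inst_mono (ch : ChaseSequence T D) {i j : ℕ} (hij : i ≤ j) (hj : (j : ℕ∞) ≤ ch.len) :
    ch.inst i ⊆ ch.inst j := by
  induction j, hij using Nat.le_induction with
  | base => exact subset_rfl
  | succ j hij ih =>
    have hlt : (j : ℕ∞) < ch.len := lt_of_lt_of_le (by exact_mod_cast Nat.lt_succ_self j) hj
    refine (ih hlt.le).trans ?_
    rw [ch.step j hlt]
    exact Set.subset_union_left

theorem head_holdsIn (ch : ChaseSequence T D) {i j : ℕ} (hij : i < j) (hj : (j : ℕ∞) ≤ ch.len) :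
    (ch.rule i).head.HoldsIn (ch.sub i) (ch.inst j) := by
  have hi : (i : ℕ∞) < ch.len := lt_of_lt_of_le (by exact_mod_cast hij) hj
  intro a ha
  refine ch.inst_mono (Nat.succ_le_of_lt hij) hj ?_
  rw [Nat.succ_eq_add_one, ch.step i hi]
  exact Or.inr ⟨a, ha, rfl⟩

theorem body_holdsIn (ch : ChaseSequence T D) {i j : ℕ} (hij : i ≤ j) (hj : (j : ℕ∞) ≤ ch.len)
    (hi : (i : ℕ∞) < ch.len) : (ch.rule i).body.HoldsIn (ch.sub i) (ch.inst j) :=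
  (ch.isMatch i hi).mono (ch.inst_mono hij hj)

theorem occursIn_of_mem_vars {A : Conj S S.Var} {σ : S.Var → GTerm S} {I : Interp S}
    (h : A.HoldsIn σ I) {x : S.Var} (hx : x ∈ A.vars) {n : S.Null} (hn : σ x = GTerm.null n) :
    OccursIn n I := by
  obtain ⟨a, ha, i, hi⟩ := hx
  refine ⟨a.subst σ, h a ha, i, ?_⟩
  simp [Atom.subst, Atom.map, hi, RTerm.elim, hn]

theorem Creates.not_occursIn {i j : ℕ} {v : S.Var} {n : S.Null} (h : ch.Creates i v n)
    (hji : j ≤ i) : ¬ OccursIn n (ch.inst j) := by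
  rintro ⟨a, ha, k, hk⟩
  obtain ⟨m, hm, hm'⟩ := ch.fresh i h.lt_len v h.mem_exVars
  have : m = n := by simpa using hm.symm.trans h.sub_eq
  subst this
  exact hm' ⟨a, ch.inst_mono hji h.lt_len.le ha, k, hk⟩

theorem Creates.occursIn {i j : ℕ} {v : S.Var} {n : S.Null} (h : ch.Creates i v n)
    (hij : i < j) (hj : (j : ℕ∞) ≤ ch.len) : OccursIn n (ch.inst j) :=
  occursIn_of_mem_vars (ch.head_holdsIn hij hj) h.mem_exVars.1 h.sub_eq

theorem Creates.step_unique {i j : ℕ} {v w : S.Var} {n : S.Null} (h : ch.Creates i v n)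
    (h' : ch.Creates j w n) : i = j := by
  rcases lt_trichotomy i j with hij | hij | hij
  · exact absurd (h.occursIn hij h'.lt_len.le) (h'.not_occursIn le_rfl)
  · exact hij
  · exact absurd (h'.occursIn hij h.lt_len.le) (h.not_occursIn le_rfl)

theorem Creates.var_unique {i j : ℕ} {v w : S.Var} {n : S.Null} (h : ch.Creates i v n)
    (h' : ch.Creates j w n) : v = w := by
  obtain rfl := h.step_unique h'
  exact ch.distinct i h.lt_len h.mem_exVars h'.mem_exVars (h.sub_eq.trans h'.sub_eq.symm)

theorem mem_inst_succ {j : ℕ} (hj : (j : ℕ∞) < ch.len) {a : Atom S (GTerm S)}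
    (ha : a ∈ ch.inst (j + 1)) : a ∈ ch.inst j ∨
      ∃ b ∈ (ch.rule j).head, a = b.subst (ch.sub j) := by
  rw [ch.step j hj] at ha
  exact ha

theorem exists_creates_of_occursIn {j : ℕ} (hj : (j : ℕ∞) ≤ ch.len) {n : S.Null}
    (h : OccursIn n (ch.inst j)) : ∃ i < j, ∃ v, ch.Creates i v n := by
  induction j with
  | zero =>
    obtain ⟨a, ha, k, hk⟩ := h
    rw [ch.init] at ha
    obtain ⟨b, -, rfl⟩ := ha
    simp [Atom.map] at hk
  | succ j ih =>
    have hlt : (j : ℕ∞) < ch.len := lt_of_lt_of_le (by exact_mod_cast Nat.lt_succ_self j) hj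
    obtain ⟨a, ha, k, hk⟩ := h
    rcases mem_inst_succ hlt ha with ha | ⟨b, hb, rfl⟩
    · obtain ⟨i, hi, v, hv⟩ := ih hlt.le ⟨a, ha, k, hk⟩
      exact ⟨i, hi.trans (Nat.lt_succ_self j), v, hv⟩
    · cases hbk : b.args k with
      | con c => simp [Atom.subst, Atom.map, hbk, RTerm.elim] at hk
      | var x =>
        simp only [Atom.subst, Atom.map, hbk, RTerm.elim] at hk
        by_cases hx : x ∈ (ch.rule j).body.vars
        · obtain ⟨i, hi, v, hv⟩ := ih hlt.le (occursIn_of_mem_vars (ch.isMatch j hlt) hx hk)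
          exact ⟨i, hi.trans (Nat.lt_succ_self j), v, hv⟩
        · exact ⟨j, Nat.lt_succ_self j, x, hlt, ⟨⟨b, hb, k, hbk⟩, hx⟩, hk⟩

/-- Nulls for `v` occur only at positions in `Omega T v`. -/
theorem Creates.position_mem_Omega (hT : RenamedApart T) {i : ℕ} {v : S.Var} {n : S.Null}
    (h : ch.Creates i v n) {j : ℕ} (hj : (j : ℕ∞) ≤ ch.len) {a : Atom S (GTerm S)}
    (ha : a ∈ ch.inst j) {k : Fin (S.arity a.pred)} (hk : a.args k = GTerm.null n) :
    (⟨a.pred, k⟩ : Position S) ∈ Omega T v := by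
  induction j generalizing a with
  | zero =>
    rw [ch.init] at ha
    obtain ⟨b, -, rfl⟩ := ha
    simp [Atom.map] at hk
  | succ j ih =>
    have hlt : (j : ℕ∞) < ch.len := lt_of_lt_of_le (by exact_mod_cast Nat.lt_succ_self j) hj
    rcases mem_inst_succ hlt ha with ha | ⟨b, hb, rfl⟩
    · exact ih hlt.le ha hk
    · cases hbk : b.args k with
      | con c => simp [Atom.subst, Atom.map, hbk, RTerm.elim] at hk
      | var x =>
        simp only [Atom.subst, Atom.map, hbk, RTerm.elim] at hk
        have hpos : (⟨b.pred, k⟩ : Position S) ∈ posHead T x :=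
          ⟨ch.rule j, ch.rule_mem j hlt, b, hb, k, hbk, rfl⟩
        by_cases hx : x ∈ (ch.rule j).body.vars
        · refine posHead_subset_Omega_of_posBody ⟨_, ch.rule_mem j hlt, hx⟩ ?_ hpos
          rintro q ⟨r, hr, c, hc, l, hl, rfl⟩
          obtain rfl := hT.eq hr (ch.rule_mem j hlt) (Or.inr ⟨c, hc, l, hl⟩) (Or.inr hx)
          have := ih hlt.le (a := c.subst (ch.sub j)) (ch.isMatch j hlt c hc) (k := l)
            (by simp [Atom.subst, Atom.map, hl, RTerm.elim, hk])
          exact this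
        · have hc : ch.Creates j x n := ⟨hlt, ⟨⟨b, hb, k, hbk⟩, hx⟩, hk⟩
          obtain rfl := h.var_unique hc
          exact posHead_subset_Omega T v hpos

/-- The dependency graph over-approximates the chase. The null `m` stands at every body position of
`x` in the matched body, so these positions lie in `Omega T u`; as rules are renamed apart, no other
rule contributes body positions of `x`. -/
theorem Creates.isEdge (hT : RenamedApart T) {i j : ℕ} {u v x : S.Var} {m n : S.Null}
    (hm : ch.Creates i u m) (hn : ch.Creates j v n) (hx : x ∈ (ch.rule j).frontier)
    (hs : ch.sub j x = GTerm.null m) : IsEdge T ⟨u, x, v⟩ := by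
  refine ⟨hm.exVars_mem, ch.rule j, hn.rule_mem, hn.mem_exVars, hx, ?_⟩
  rintro q ⟨r, hr, c, hc, l, hl, rfl⟩
  obtain rfl := hT.eq hr hn.rule_mem (Or.inr ⟨c, hc, l, hl⟩) (Or.inr hx.2)
  exact hm.position_mem_Omega hT hn.lt_len.le (a := c.subst (ch.sub j))
    (ch.isMatch j hn.lt_len c hc) (k := l) (by simp [Atom.subst, Atom.map, hl, RTerm.elim, hs])

theorem Creates.lt_of_sub_eq {i j : ℕ} {u x : S.Var} {m : S.Null}
    (hm : ch.Creates i u m) (hj : (j : ℕ∞) < ch.len) (hx : x ∈ (ch.rule j).frontier)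
    (hs : ch.sub j x = GTerm.null m) : i < j := by
  by_contra hlt
  exact hm.not_occursIn (not_lt.1 hlt) (occursIn_of_mem_vars (ch.isMatch j hj) hx.2 hs)

theorem exists_creates_of_sub_eq {j : ℕ} {x : S.Var} {m : S.Null}
    (hj : (j : ℕ∞) < ch.len) (hx : x ∈ (ch.rule j).frontier)
    (hs : ch.sub j x = GTerm.null m) : ∃ i u, ch.Creates i u m := by
  obtain ⟨i, -, u, h⟩ :=
    exists_creates_of_occursIn hj.le (occursIn_of_mem_vars (ch.isMatch j hj) hx.2 hs)
  exact ⟨i, u, h⟩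

/-- A tgd is not applied if its head already holds for the given values of the frontier variables. -/
theorem not_holdsIn_head (ch : ChaseSequence T D) {j : ℕ} (hj : (j : ℕ∞) < ch.len)
    {τ : S.Var → GTerm S} (hτ : ∀ x ∈ (ch.rule j).frontier, τ x = ch.sub j x) :
    ¬ (ch.rule j).head.HoldsIn τ (ch.inst j) := by
  classical
  intro h
  -- Body variables outside the frontier do not occur in the head, so resetting them to their
  -- matched values does no harm.
  refine ch.unsatisfied j hj
    ⟨fun x => if x ∈ (ch.rule j).body.vars then ch.sub j x else τ x, fun x hx => if_pos hx, ?_⟩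
  refine h.congr fun x hx => ?_
  by_cases hb : x ∈ (ch.rule j).body.vars
  · rw [if_pos hb, hτ x ⟨hx, hb⟩]
  · rw [if_neg hb]

/-- A null is determined by its variable and the values of the frontier variables. -/
theorem Creates.eq_of_frontier_eq (hT : RenamedApart T) {i j : ℕ} {v : S.Var} {m n : S.Null}
    (hm : ch.Creates i v m) (hn : ch.Creates j v n)
    (h : ∀ x ∈ (tgdOf T v).frontier, ch.sub i x = ch.sub j x) : m = n := by
  -- The earlier of two such applications leaves a head instance that satisfies the later match.
  have key : ∀ {i j : ℕ} {m n : S.Null}, ch.Creates i v m → ch.Creates j v n →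
      (∀ x ∈ (tgdOf T v).frontier, ch.sub i x = ch.sub j x) → ¬ i < j := by
    intro i j m n hm hn h hij
    rw [hn.tgdOf_eq hT] at h
    refine ch.not_holdsIn_head hn.lt_len h ?_
    have := ch.head_holdsIn hij hn.lt_len.le
    rwa [← hm.tgdOf_eq hT, hn.tgdOf_eq hT] at this
  have h1 := key hm hn h
  have h2 := key hn hm fun x hx => (h x hx).symm
  obtain rfl : i = j := by omega
  simpa using hm.sub_eq.symm.trans hn.sub_eq

/-- A frontier value is read off a body atom, so an invariant for atoms with body predicates
suffices. It is inductive: a constant passed on by a body variable was already in such an atom. -/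
theorem mem_relevantConstants {j : ℕ} (hj : (j : ℕ∞) ≤ ch.len) {a : Atom S (GTerm S)}
    (ha : a ∈ ch.inst j) (hp : ∃ r ∈ T, ∃ b ∈ r.body, b.pred = a.pred) {k : Fin (S.arity a.pred)}
    {c : S.Con} (hk : a.args k = GTerm.con c) : c ∈ relevantConstants T D := by
  induction j generalizing a with
  | zero =>
    rw [ch.init] at ha
    obtain ⟨b, hb, rfl⟩ := ha
    refine Or.inl ⟨b, hb, hp, k, ?_⟩
    simpa [Atom.map] using hk
  | succ j ih =>
    have hlt : (j : ℕ∞) < ch.len := lt_of_lt_of_le (by exact_mod_cast Nat.lt_succ_self j) hj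
    rcases mem_inst_succ hlt ha with ha | ⟨b, hb, rfl⟩
    · exact ih hlt.le ha hp hk
    · cases hbk : b.args k with
      | con d =>
        simp only [Atom.subst, Atom.map, hbk, RTerm.elim, GTerm.con.injEq] at hk
        exact Or.inr ⟨_, ch.rule_mem j hlt, b, hb, k, by rw [← hk]; exact hbk⟩
      | var x =>
        simp only [Atom.subst, Atom.map, hbk, RTerm.elim] at hk
        by_cases hx : x ∈ (ch.rule j).body.vars
        · obtain ⟨d, hd, l, hl⟩ := hx
          exact ih hlt.le (a := d.subst (ch.sub j)) (ch.isMatch j hlt d hd)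
            ⟨_, ch.rule_mem j hlt, d, hd, rfl⟩ (k := l)
            (by simp [Atom.subst, Atom.map, hl, RTerm.elim, hk])
        · obtain ⟨n, hn, -⟩ := ch.fresh j hlt x ⟨⟨b, hb, k, hbk⟩, hx⟩
          rw [hn] at hk
          cases hk

theorem sub_mem_relevantConstants {j : ℕ} (hj : (j : ℕ∞) < ch.len) {x : S.Var}
    (hx : x ∈ (ch.rule j).frontier) {c : S.Con} (hs : ch.sub j x = GTerm.con c) :
    c ∈ relevantConstants T D := by
  obtain ⟨-, d, hd, l, hl⟩ := hx
  exact mem_relevantConstants hj.le (a := d.subst (ch.sub j)) (ch.isMatch j hj d hd)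
    ⟨_, ch.rule_mem j hj, d, hd, rfl⟩ (k := l)
    (by simp [Atom.subst, Atom.map, hl, RTerm.elim, hs])

end ChaseSequence

/-- The restriction to body predicates is what makes the bound polynomial in the number of atoms:
their arities are bounded in terms of `T`, whereas a database may use other predicates of
arbitrarily large arity. -/
theorem exists_bound_relevantConstants {S : Signature} (T : TGDSet S) :
    ∃ p : Polynomial ℕ, ∀ D : Database S,
      (relevantConstants T D).Finite ∧ (relevantConstants T D).ncard ≤ p.eval D.card := by
  classical
  obtain ⟨M, hM⟩ : ∃ M, ∀ r ∈ T, ∀ b ∈ r.body, S.arity b.pred ≤ M := by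
    have hfin : {k | ∃ r ∈ T, ∃ b ∈ r.body, k = S.arity b.pred}.Finite := by
      have : {k | ∃ r ∈ T, ∃ b ∈ r.body, k = S.arity b.pred} ⊆
          ⋃ r ∈ (T : Set (TGD S S.Var)), (fun b => S.arity b.pred) '' {b | b ∈ r.body} := by
        rintro k ⟨r, hr, b, hb, rfl⟩
        simp only [Set.mem_iUnion]
        exact ⟨r, hr, b, hb, rfl⟩
      exact (T.finite_toSet.biUnion fun r _ => (List.finite_toSet r.body).image _).subset this
    obtain ⟨M, hM⟩ := hfin.bddAbove
    exact ⟨M, fun r hr b hb => hM ⟨r, hr, b, hb, rfl⟩⟩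
  have hhead : {c : S.Con | ∃ r ∈ T, ∃ b ∈ r.head, ∃ i, b.args i = RTerm.con c}.Finite := by
    have h : {c : S.Con | ∃ r ∈ T, ∃ b ∈ r.head, ∃ i, b.args i = RTerm.con c} ⊆
        ⋃ r ∈ (T : Set (TGD S S.Var)), ⋃ a ∈ {a | a ∈ r.head},
          ⋃ i, {c | a.args i = RTerm.con c} := by
      rintro v ⟨r, hr, a, ha, i, hi⟩
      simp only [Set.mem_iUnion]
      exact ⟨r, hr, a, ha, i, hi⟩
    refine Set.Finite.subset ?_ h
    refine T.finite_toSet.biUnion fun r _ => (List.finite_toSet r.head).biUnion fun a _ => ?_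
    refine Set.finite_iUnion fun i => Set.Subsingleton.finite ?_
    intro x hx y hy
    simpa using hx.symm.trans hy
  refine ⟨Polynomial.X * Polynomial.C M + Polynomial.C (Set.ncard
    {c : S.Con | ∃ r ∈ T, ∃ b ∈ r.head, ∃ i, b.args i = RTerm.con c}), fun D => ?_⟩
  let U : Finset S.Con := (D.filter fun a => ∃ r ∈ T, ∃ b ∈ r.body, b.pred = a.pred).biUnion
    fun a => Finset.univ.image a.args
  have hU : {c : S.Con | ∃ a ∈ D, (∃ r ∈ T, ∃ b ∈ r.body, b.pred = a.pred) ∧ ∃ i, a.args i = c} =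
      (U : Set S.Con) := by
    ext c
    simp [U, and_assoc]
  have hUcard : U.card ≤ D.card * M := by
    refine (Finset.card_biUnion_le_card_mul _ _ M fun a ha => ?_).trans
      (Nat.mul_le_mul_right _ (Finset.card_filter_le _ _))
    obtain ⟨-, r, hr, b, hb, hba⟩ := Finset.mem_filter.1 ha
    refine Finset.card_image_le.trans ?_
    simpa [← hba] using hM r hr b hb
  rw [relevantConstants, hU]
  refine ⟨U.finite_toSet.union hhead, (Set.ncard_union_le _ _).trans ?_⟩
  rw [Set.ncard_coe_finset]
  simpa using hUcard

/-! ### Path queries of segments of an edge sequence -/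

section Segments
variable {S : Signature}

/-- The list of the `k` edges `f a, f (a + 1), …`. -/
def segment (f : ℕ → Edge S) : ℕ → ℕ → List (Edge S)
  | _, 0 => []
  | a, k + 1 => f a :: segment f (a + 1) k

theorem length_segment (f : ℕ → Edge S) (a k : ℕ) : (segment f a k).length = k := by
  induction k generalizing a with
  | zero => rfl
  | succ k ih => simp [segment, ih]

theorem getElem?_segment (f : ℕ → Edge S) (a k j : ℕ) :
    (segment f a k)[j]? = if j < k then some (f (a + j)) else none := by
  induction k generalizing a j with
  | zero => simp [segment]
  | succ k ih =>
    cases j with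
    | zero => simp [segment]
    | succ j => simp [segment, ih, Nat.add_assoc, Nat.add_comm 1 j]

theorem segment_append (f : ℕ → Edge S) (a k l : ℕ) :
    segment f a k ++ segment f (a + k) l = segment f a (k + l) := by
  induction k generalizing a with
  | zero => simp [segment]
  | succ k ih =>
    have := ih (a + 1)
    rw [Nat.add_right_comm, Nat.add_assoc a k 1] at this
    rw [Nat.add_right_comm k 1 l]
    simp [segment, this]

theorem joint_segment (f : ℕ → Edge S) (a k i : ℕ) :
    joint (segment f a k) i = if i < k then .copy i (f (a + i)).lbl else .last := by
  rw [joint, getElem?_segment]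
  split_ifs <;> rfl

theorem mem_zipIdx_segment {f : ℕ → Edge S} {a k : ℕ} {x : Edge S × ℕ} :
    x ∈ (segment f a k).zipIdx ↔ x.2 < k ∧ x.1 = f (a + x.2) := by
  rw [List.mem_zipIdx_iff_getElem?, getElem?_segment]
  split_ifs with h
  · simp [h, eq_comm]
  · simp [h]

theorem isPath_segment {G : Set (Edge S)} {f : ℕ → Edge S} {vr : ℕ → S.Var} {a k : ℕ}
    (h : ∀ i < k, f (a + i) ∈ G)
    (hs : ∀ i < k, (f (a + i)).src = vr (a + i))
    (ht : ∀ i < k, (f (a + i)).tgt = vr (a + i + 1)) :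
    IsPath G (vr a) (segment f a k) (vr (a + k)) := by
  induction k generalizing a with
  | zero => rfl
  | succ k ih =>
    refine ⟨h 0 k.succ_pos, hs 0 k.succ_pos, ?_⟩
    rw [show (f a).tgt = vr (a + 1) from ht 0 k.succ_pos,
      show a + (k + 1) = a + 1 + k by omega]
    have e : ∀ i, a + 1 + i = a + (i + 1) := fun i => by omega
    refine ih (fun i hi => ?_) (fun i hi => ?_) (fun i hi => ?_)
    · rw [e]; exact h (i + 1) (by omega)
    · rw [e]; exact hs (i + 1) (by omega)
    · rw [e]; exact ht (i + 1) (by omega)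

/-- Every joint but the initial one occurs in the path query. -/
theorem joint_mem_vars_pathQuery {T : TGDSet S} (hT : RenamedApart T) {f : ℕ → Edge S} {a k : ℕ}
    (h : ∀ i < k, (f (a + i)).tgt ∈ exVars T) {i : ℕ} (hi : 0 < i) (hik : i ≤ k) :
    joint (segment f a k) i ∈ (pathQuery T (segment f a k)).vars := by
  classical
  obtain ⟨i, rfl⟩ : ∃ j, i = j + 1 := ⟨i - 1, by omega⟩
  obtain ⟨r, hr, hv⟩ := h i (by omega)
  have hhead := hv.1
  rw [← tgdOf_eq hT hr hv] at hhead
  obtain ⟨b, hb, l, hl⟩ := Conj.mem_vars_map_rename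
    (fun x => if x = (f (a + i)).tgt then joint (segment f a k) (i + 1) else .copy i x) hhead
  rw [if_pos rfl] at hl
  refine ⟨b, ?_, l, hl⟩
  refine List.mem_flatMap.2 ⟨(f (a + i), i), mem_zipIdx_segment.2 ⟨by simpa using hik, rfl⟩, ?_⟩
  refine List.mem_append_right _ ?_
  unfold pathHead
  convert hb

/-- `SatMatch` preserves the values of body variables only. To read off the entailed head instance,
its variables must be known to occur in the path query. -/
theorem copy_zero_mem_vars_pathQuery {T : TGDSet S} {f : ℕ → Edge S} {a k : ℕ}
    (hk : 0 < k) {x : S.Var} (hx : x ∈ (tgdOf T (f a).tgt).head.vars) (hne : x ≠ (f a).tgt) :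
    PVar.copy 0 x ∈ (pathQuery T (segment f a k)).vars := by
  classical
  obtain ⟨b, hb, l, hl⟩ := Conj.mem_vars_map_rename
    (fun x => if x = (f a).tgt then joint (segment f a k) (0 + 1) else .copy 0 x) hx
  rw [if_neg hne] at hl
  refine ⟨b, ?_, l, hl⟩
  refine List.mem_flatMap.2 ⟨(f a, 0), mem_zipIdx_segment.2 ⟨hk, rfl⟩, ?_⟩
  refine List.mem_append_right _ ?_
  unfold pathHead
  convert hb

theorem Conj.vars_append_left {X : Type} {A B : Conj S X} {x : X} (h : x ∈ A.vars) :
    x ∈ Conj.vars (S := S) (A ++ B) := by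
  obtain ⟨a, ha, i, hi⟩ := h
  exact ⟨a, List.mem_append_left _ ha, i, hi⟩

theorem Conj.vars_append_right {X : Type} {A B : Conj S X} {x : X} (h : x ∈ B.vars) :
    x ∈ Conj.vars (S := S) (A ++ B) := by
  obtain ⟨a, ha, i, hi⟩ := h
  exact ⟨a, List.mem_append_right _ ha, i, hi⟩

end Segments

/-! ### Chains of nulls and propagation along them -/

namespace ChaseSequence
variable {S : Signature} {T : TGDSet S} {D : Database S}

/-- A chain of nulls `nul 0, …, nul k` with variables in `C`, where `nul j` is the value of the
frontier variable `lbl j` in the step `step (j + 1)` that introduces `nul (j + 1)`. -/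
structure NullChain (ch : ChaseSequence T D) (C : Set S.Var) (k : ℕ) where
  nul : ℕ → S.Null
  var : ℕ → S.Var
  step : ℕ → ℕ
  lbl : ℕ → S.Var
  creates : ∀ j ≤ k, ch.Creates (step j) (var j) (nul j)
  mem : ∀ j ≤ k, var j ∈ C
  lbl_mem : ∀ j < k, lbl j ∈ (ch.rule (step (j + 1))).frontier
  sub_lbl : ∀ j < k, ch.sub (step (j + 1)) (lbl j) = GTerm.null (nul j)

namespace NullChain
variable {ch : ChaseSequence T D} {C : Set S.Var} {K : ℕ}

def edge (c : ch.NullChain C K) (j : ℕ) : Edge S := ⟨c.var j, c.lbl j, c.var (j + 1)⟩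

theorem edge_mem (hT : RenamedApart T) (c : ch.NullChain C K) {j : ℕ} (hj : j < K) :
    c.edge j ∈ edgesIn T C :=
  ⟨(c.creates j hj.le).isEdge hT (c.creates (j + 1) hj) (c.lbl_mem j hj) (c.sub_lbl j hj),
    c.mem j hj.le, c.mem (j + 1) hj⟩

theorem step_lt (c : ch.NullChain C K) {i j : ℕ} (hij : i < j) (hj : j ≤ K) :
    c.step i < c.step j := by
  induction j, hij using Nat.le_induction with
  | base =>
    exact (c.creates i (Nat.le_of_succ_le hj)).lt_of_sub_eq (c.creates (i + 1) hj).lt_len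
      (c.lbl_mem i hj) (c.sub_lbl i hj)
  | succ j hij ih =>
    exact (ih (by omega)).trans ((c.creates j (by omega)).lt_of_sub_eq (c.creates (j + 1) hj).lt_len
        (c.lbl_mem j hj) (c.sub_lbl j hj))

/-- The values of the variables of the path query for the edges `a, …, b - 1` of a chain, with values
`φ` of the further variables. -/
def pathSub (c : ch.NullChain C K) (a b : ℕ) (φ : S.Var → GTerm S) : PVar S → GTerm S
  | .copy i x => ch.sub (c.step (a + i + 1)) x
  | .last => GTerm.null (c.nul b)
  | .fresh x => φ x

theorem pathSub_joint (c : ch.NullChain C K) {a k : ℕ} (h : a + k ≤ K) (φ : S.Var → GTerm S)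
    {i : ℕ} (hi : i ≤ k) :
    c.pathSub a (a + k) φ (joint (segment c.edge a k) i) = GTerm.null (c.nul (a + i)) := by
  rw [joint_segment]
  split_ifs with hik
  · exact c.sub_lbl (a + i) (by omega)
  · obtain rfl : i = k := by omega
    rfl

/-- The bodies and heads in the query are those of the steps that created the chain nulls up to
index `a + k`. The bound `a + k < K` provides one more null, in whose step all of these are already
present. -/
theorem pathQuery_holdsIn (hT : RenamedApart T) (c : ch.NullChain C K) {a k : ℕ} (h : a + k < K)
    (φ : S.Var → GTerm S) :
    (pathQuery T (segment c.edge a k)).HoldsIn (c.pathSub a (a + k) φ)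
      (ch.inst (c.step (a + k + 1))) := by
  classical
  intro b hb
  obtain ⟨⟨e, i⟩, hei, hb⟩ := List.mem_flatMap.1 hb
  have he := mem_zipIdx_segment.1 hei
  simp only at he hb
  obtain ⟨hi, rfl⟩ := he
  have hcr := c.creates (a + i + 1) (by omega)
  have hlen := (c.creates (a + k + 1) (by omega)).lt_len.le
  have hlt : c.step (a + i + 1) < c.step (a + k + 1) := c.step_lt (by omega) (by omega)
  have htgd : tgdOf T (c.edge (a + i)).tgt = ch.rule (c.step (a + i + 1)) := hcr.tgdOf_eq hT
  rcases List.mem_append.1 hb with hb | hb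
  · rw [pathBody, htgd] at hb
    refine Conj.holdsIn_map_rename.2 ?_ b hb
    exact ch.body_holdsIn hlt.le hlen hcr.lt_len
  · rw [pathHead, htgd] at hb
    refine Conj.holdsIn_map_rename.2 ((ch.head_holdsIn hlt hlen).congr fun x _ => ?_) b hb
    split_ifs with hx
    · rw [c.pathSub_joint h.le φ (by omega), hx]
      exact hcr.sub_eq
    · rfl

/-- The values of the head variables in an instance of the head of the tgd of `c.edge a` in which the
edge source is replaced by `nul t` and the edge target by `nul s`. -/
noncomputable def shifted (c : ch.NullChain C K) (a t s : ℕ) (x : S.Var) : GTerm S :=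
  open Classical in
  if x = c.lbl a then GTerm.null (c.nul t)
  else if x = c.var (a + 1) then GTerm.null (c.nul s)
  else ch.sub (c.step (a + 1)) x

/-- The head of the tgd of the edge `a` holds with source `nul t` and target `nul s`, in the step that
follows the null `nul t`. -/
def HeadHolds (c : ch.NullChain C K) (a t s : ℕ) : Prop :=
  (tgdOf T (c.var (a + 1))).head.HoldsIn (c.shifted a t s) (ch.inst (c.step (t + 1)))

theorem datalog_satisfied (c : ch.NullChain C K) {j : ℕ} (hj : j ≤ K) :
    ∀ d ∈ T, d.IsDatalog → d.SatisfiedBy (ch.inst (c.step j)) := by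
  have h := c.creates j hj
  refine ch.datalog_first _ h.lt_len fun hd => ?_
  have := h.mem_exVars
  rw [hd] at this
  exact this

theorem tgt_mem_exVars (c : ch.NullChain C K) {j : ℕ} (hj : j < K) :
    (c.edge j).tgt ∈ exVars T := (c.creates (j + 1) hj).exVars_mem

/-- The step that creates the null after the segment applies a rule with an existential variable. By
the Datalog-first strategy its instance satisfies the Datalog rules, so the entailment can be
evaluated there. -/
theorem headHolds_of_basePropagating (hT : RenamedApart T) (c : ch.NullChain C K) {a k : ℕ}
    (h : a + (k + 1) < K) (hb : BasePropagating T (c.edge a) (segment c.edge (a + 1) k)) :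
    c.HeadHolds a (a + (k + 1)) (a + 1) := by
  classical
  have hp : c.edge a :: segment c.edge (a + 1) k = segment c.edge a (k + 1) := rfl
  unfold BasePropagating at hb
  rw [hp, length_segment] at hb
  obtain ⟨σ, hσ, hhead⟩ := hb _ (c.datalog_satisfied (j := a + (k + 1) + 1) (by omega)) _
    (c.pathQuery_holdsIn hT h fun x => ch.sub 0 x)
  have htgt : ∀ i < k + 1, (c.edge (a + i)).tgt ∈ exVars T :=
    fun i hi => c.tgt_mem_exVars (by omega)
  refine Conj.HoldsIn.congr (Conj.holdsIn_map_rename.1 hhead) fun x hx => ?_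
  unfold shifted
  change σ (if x = c.lbl a then _ else if x = c.var (a + 1) then _ else _) = _
  split_ifs with h1 h2
  · rw [hσ _ (joint_mem_vars_pathQuery hT htgt (by omega) le_rfl), c.pathSub_joint h.le _ le_rfl]
  · rw [hσ _ (joint_mem_vars_pathQuery hT htgt (by omega) (by omega)),
      c.pathSub_joint h.le _ (by omega)]
  · rw [hσ _ (copy_zero_mem_vars_pathQuery (by omega) hx h2)]
    rfl

theorem headHolds_of_stepPropagating (hT : RenamedApart T) (c : ch.NullChain C K)
    {d a k l : ℕ} (hk : 0 < k) (hl : 0 < l) (h : a + (k + l) < K)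
    (hs : StepPropagating T (segment c.edge a k) (segment c.edge (a + k) l) (c.edge d))
    (hold : c.HeadHolds d (a + k) (a + 1)) :
    c.HeadHolds d (a + (k + l)) (a + k + 1) := by
  classical
  unfold StepPropagating at hs
  rw [segment_append, length_segment, length_segment] at hs
  have htgt : ∀ i < k + l, (c.edge (a + i)).tgt ∈ exVars T :=
    fun i hi => c.tgt_mem_exVars (by omega)
  -- The fresh variables take the values of the step that realised edge `d`; this is how the context
  -- of `d` stays fixed throughout the propagation.
  set φ : S.Var → GTerm S := fun x => ch.sub (c.step (d + 1)) x
  have hle : c.step (a + k + 1) ≤ c.step (a + (k + l) + 1) :=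
    (c.step_lt (by omega) (by omega)).le
  have hlen := (c.creates (a + (k + l) + 1) (by omega)).lt_len.le
  obtain ⟨σ, hσ, hhead⟩ := hs _ (c.datalog_satisfied (j := a + (k + l) + 1) (by omega))
    (c.pathSub a (a + (k + l)) φ) (by
      intro b hb
      rcases List.mem_append.1 hb with hb | hb
      · exact c.pathQuery_holdsIn hT h φ b hb
      · refine Conj.holdsIn_map_rename.2 ?_ b hb
        refine (hold.mono (ch.inst_mono hle hlen)).congr fun x hx => ?_
        unfold shifted
        change _ = c.pathSub a (a + (k + l)) φ
          (if x = c.lbl d then _ else if x = c.var (d + 1) then _ else _)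
        split_ifs with h1 h2
        · rw [c.pathSub_joint h.le _ (by omega)]
        · rw [c.pathSub_joint h.le _ (by omega)]
        · rfl)
  refine Conj.HoldsIn.congr (Conj.holdsIn_map_rename.1 hhead) fun x hx => ?_
  unfold shifted
  change σ (if x = c.lbl d then _ else if x = c.var (d + 1) then _ else _) = _
  split_ifs with h1 h2
  · rw [hσ _ (Conj.vars_append_left (joint_mem_vars_pathQuery hT htgt (by omega) le_rfl)),
      c.pathSub_joint h.le _ le_rfl]
  · rw [hσ _ (Conj.vars_append_left (joint_mem_vars_pathQuery hT htgt (by omega) (by omega))),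
      c.pathSub_joint h.le _ (by omega)]
    rfl
  · rw [hσ _ (Conj.vars_append_right ?_)]
    · rfl
    · have := Conj.mem_vars_map_rename (fun x => if x = (c.edge d).lbl then
        joint (segment c.edge a (k + l)) k else if x = (c.edge d).tgt then
        joint (segment c.edge a (k + l)) 1 else .fresh x) hx
      rw [if_neg (show ¬ x = (c.edge d).lbl from h1),
        if_neg (show ¬ x = (c.edge d).tgt from h2)] at this
      unfold headInst
      convert this using 4
      rfl

variable {E : Set (Edge S)}

theorem isPath_segment (hT : RenamedApart T) (c : ch.NullChain C K) {a b : ℕ} (hab : a ≤ b)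
    (hb : b ≤ K) (h : ∀ i, a ≤ i → i < b → c.edge i ∉ E) :
    IsPath (edgesIn T C \ E) (c.var a) (segment c.edge a (b - a)) (c.var b) := by
  have := Chase.isPath_segment (G := edgesIn T C \ E) (f := c.edge) (vr := c.var) (a := a)
    (k := b - a) (fun i hi => ⟨c.edge_mem hT (by omega), h _ (by omega) (by omega)⟩)
    (fun i hi => rfl) (fun i hi => rfl)
  rwa [Nat.add_sub_cancel' hab] at this

/-- Propagation along a chain: after an edge `a` in `E`, the head of its tgd holds for the source of
every further edge `t` in `E` together with the target of the preceding edge in `E`. -/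
theorem exists_headHolds (hT : RenamedApart T) (hE : IsSaturating T C E) (c : ch.NullChain C K)
    {a : ℕ} (ha : c.edge a ∈ E) (t : ℕ) (hat : a < t) (htK : t < K) (ht : c.edge t ∈ E) :
    ∃ s, a ≤ s ∧ s < t ∧ c.edge s ∈ E ∧ (∀ i, s < i → i < t → c.edge i ∉ E) ∧
      c.HeadHolds a t (s + 1) := by
  classical
  induction t using Nat.strong_induction_on with
  | _ t ih =>
  -- The last edge in `E` before `t`, which exists since `a` itself is a candidate. For `s = a`
  -- base-propagation applies; otherwise the induction hypothesis at `s` is moved on to `t` by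
  -- step-propagation.
  obtain ⟨s, ⟨has, hst, hs⟩, hmax⟩ : ∃ s, (a ≤ s ∧ s < t ∧ c.edge s ∈ E) ∧
      ∀ i, (a ≤ i ∧ i < t ∧ c.edge i ∈ E) → i ≤ s := by
    have hne : ((Finset.range t).filter fun i => a ≤ i ∧ c.edge i ∈ E).Nonempty :=
      ⟨a, by simp [hat, ha]⟩
    refine ⟨Finset.max' _ hne, ?_, fun i hi => Finset.le_max' _ i
      (Finset.mem_filter.2 ⟨Finset.mem_range.2 hi.2.1, hi.1, hi.2.2⟩)⟩
    have := Finset.max'_mem _ hne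
    rw [Finset.mem_filter, Finset.mem_range] at this
    exact ⟨this.2.1, this.1, this.2.2⟩
  have hgap : ∀ i, s < i → i < t → c.edge i ∉ E := by
    intro i hsi hit hi
    have := hmax i ⟨by omega, hit, hi⟩
    omega
  refine ⟨s, has, hst, hs, hgap, ?_⟩
  have hpath : IsEBarPath T C E (c.edge s).tgt (segment c.edge (s + 1) (t - (s + 1))) (c.var t) :=
    ⟨c.isPath_segment hT hst htK.le fun i hi => hgap i (by omega), ⟨_, hs, rfl⟩, ⟨_, ht, rfl⟩⟩
  rcases has.eq_or_lt with rfl | has'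
  · have := c.headHolds_of_basePropagating hT (a := a) (k := t - (a + 1)) (by omega)
      (hE.base _ hs _ _ hpath)
    rwa [show a + (t - (a + 1) + 1) = t by omega] at this
  · obtain ⟨r, har, hrs, hr, hgap', hold⟩ := ih s hst has' (hst.trans htK) hs
    have hpath' : IsEBarPath T C E (c.edge r).tgt (segment c.edge (r + 1) (s - (r + 1)))
        (c.edge s).src :=
      ⟨c.isPath_segment hT hrs (by omega) fun i hi => hgap' i (by omega), ⟨_, hr, rfl⟩,
        ⟨_, hs, rfl⟩⟩
    have hstep := hE.step _ hr _ hs _ _ _ hpath' hpath _ ha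
    have e1 : c.edge r :: segment c.edge (r + 1) (s - (r + 1)) = segment c.edge r (s - r) := by
      rw [show s - r = s - (r + 1) + 1 by omega]
      rfl
    have e2 : c.edge s :: segment c.edge (s + 1) (t - (s + 1)) =
        segment c.edge (r + (s - r)) (t - s) := by
      rw [show t - s = t - (s + 1) + 1 by omega, show r + (s - r) = s by omega]
      rfl
    rw [e1, e2] at hstep
    have := c.headHolds_of_stepPropagating hT (d := a) (a := r) (k := s - r) (l := t - s)
      (by omega) (by omega) (by omega) hstep
      (by rwa [show r + (s - r) = s by omega])
    rwa [show r + (s - r + (t - s)) = t by omega, show r + (s - r) + 1 = s + 1 by omega] at this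

/-- In a chain, an edge in `E` does not occur twice with the same values of the other frontier
variables. -/
theorem not_repeated (hT : RenamedApart T) (hE : IsSaturating T C E) (c : ch.NullChain C K)
    {a t : ℕ} (hat : a < t) (htK : t < K) (ha : c.edge a ∈ E) (he : c.edge a = c.edge t)
    (hctx : ∀ x ∈ (tgdOf T (c.edge a).tgt).frontier, x ≠ (c.edge a).lbl →
      ch.sub (c.step (a + 1)) x = ch.sub (c.step (t + 1)) x) : False := by
  obtain ⟨s, -, -, -, -, hold⟩ := c.exists_headHolds hT hE ha t hat htK (he ▸ ha)
  have hcr := c.creates (t + 1) htK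
  have hv : c.var (a + 1) = c.var (t + 1) := congrArg Edge.tgt he
  have hl : c.lbl a = c.lbl t := congrArg Edge.lbl he
  have htgd : tgdOf T (c.var (a + 1)) = ch.rule (c.step (t + 1)) := by
    rw [hv]; exact hcr.tgdOf_eq hT
  unfold HeadHolds at hold
  rw [htgd] at hold
  -- The propagated instance has the label set to `nul t` and the context of edge `a`, which by
  -- assumption is that of edge `t`. Hence it satisfies the match used to create `nul (t + 1)`.
  refine ch.not_holdsIn_head hcr.lt_len (fun x hx => ?_) hold
  unfold shifted
  split_ifs with h1 h2
  · rw [h1, hl]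
    exact (c.sub_lbl t htK).symm
  · exact absurd hx.2 (by rw [h2, hv]; exact hcr.mem_exVars.2)
  · exact hctx x (by rw [show (c.edge a).tgt = c.var (a + 1) from rfl, htgd]; exact hx) h1

end NullChain
end ChaseSequence

/-! ### Arithmetic of iterated exponentials -/

theorem tower_mono (k : ℕ) {m n : ℕ} (h : m ≤ n) : tower k m ≤ tower k n := by
  induction k with
  | zero => exact h
  | succ k ih => exact Nat.pow_le_pow_right (by norm_num) ih

theorem tower_le_tower_succ (k m : ℕ) : tower k m ≤ tower (k + 1) m :=
  Nat.lt_two_pow_self.le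

theorem tower_succ_le (k m : ℕ) : tower k m + 1 ≤ tower k (m + 1) := by
  induction k with
  | zero => exact le_rfl
  | succ k ih =>
    have h1 : 2 ^ (tower k m + 1) ≤ 2 ^ tower k (m + 1) := Nat.pow_le_pow_right (by norm_num) ih
    have h2 : 1 ≤ 2 ^ tower k m := Nat.one_le_two_pow
    simp only [tower]
    omega

theorem two_mul_tower_le (k m : ℕ) : 2 * tower k m ≤ tower k (2 * m + 1) := by
  cases k with
  | zero => simp [tower]
  | succ k =>
    have h := (tower_succ_le k m).trans (tower_mono k (show m + 1 ≤ 2 * m + 1 by omega))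
    have h1 : 2 ^ (tower k m + 1) ≤ 2 ^ tower k (2 * m + 1) :=
      Nat.pow_le_pow_right (by norm_num) h
    simp only [tower]
    omega

theorem tower_add_le (k m n : ℕ) : tower k m + tower k n ≤ tower k (2 * (m + n) + 1) := by
  have h1 := tower_mono k (Nat.le_add_right m n)
  have h2 := tower_mono k (Nat.le_add_left n m)
  have h3 := two_mul_tower_le k (m + n)
  omega

/-- At height 0 the product itself is needed; at positive height a product becomes a sum of
exponents. The argument on the right covers both. -/
theorem tower_mul_le (k m n : ℕ) : tower k m * tower k n ≤ tower k (m * n + 2 * (m + n) + 1) := by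
  cases k with
  | zero => simp only [tower]; omega
  | succ k =>
    simp only [tower]
    rw [← pow_add]
    exact Nat.pow_le_pow_right (by norm_num)
      ((tower_add_le k m n).trans (tower_mono k (by omega)))

namespace IsKExponential
variable {k l : ℕ} {f g : ℕ → ℕ}

theorem mono (hf : IsKExponential k f) (h : ∀ n, g n ≤ f n) : IsKExponential k g := by
  obtain ⟨p, hp⟩ := hf
  exact ⟨p, fun n => (h n).trans (hp n)⟩

theorem mono_height (hf : IsKExponential k f) (h : k ≤ l) : IsKExponential l f := by
  obtain ⟨p, hp⟩ := hf
  refine ⟨p, fun n => (hp n).trans ?_⟩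
  induction l, h using Nat.le_induction with
  | base => exact le_rfl
  | succ l _ ih => exact ih.trans (tower_le_tower_succ l _)

theorem polynomial (k : ℕ) (p : Polynomial ℕ) : IsKExponential k fun n => p.eval n :=
  mono_height (k := 0) ⟨p, fun _ => le_rfl⟩ (Nat.zero_le k)

theorem const (k c : ℕ) : IsKExponential k fun _ => c :=
  (polynomial k (Polynomial.C c)).mono fun n => by simp

theorem add (hf : IsKExponential k f) (hg : IsKExponential k g) :
    IsKExponential k fun n => f n + g n := by
  obtain ⟨p, hp⟩ := hf
  obtain ⟨q, hq⟩ := hg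
  refine ⟨Polynomial.C 2 * (p + q) + Polynomial.C 1, fun n => ?_⟩
  refine (Nat.add_le_add (hp n) (hq n)).trans ?_
  simpa using tower_add_le k (p.eval n) (q.eval n)

theorem mul (hf : IsKExponential k f) (hg : IsKExponential k g) :
    IsKExponential k fun n => f n * g n := by
  obtain ⟨p, hp⟩ := hf
  obtain ⟨q, hq⟩ := hg
  refine ⟨p * q + Polynomial.C 2 * (p + q) + Polynomial.C 1, fun n => ?_⟩
  refine (Nat.mul_le_mul (hp n) (hq n)).trans ?_
  simpa using tower_mul_le k (p.eval n) (q.eval n)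

theorem pow_const (hf : IsKExponential k f) (c : ℕ) : IsKExponential k fun n => f n ^ c := by
  induction c with
  | zero => exact const k 1
  | succ c ih => exact ih.mul hf

theorem sum {ι : Type*} (s : Finset ι) {F : ι → ℕ → ℕ} (h : ∀ i ∈ s, IsKExponential k (F i)) :
    IsKExponential k fun n => ∑ i ∈ s, F i n := by
  classical
  induction s using Finset.induction_on with
  | empty => exact const k 0
  | insert a s ha ih =>
    simp only [Finset.sum_insert ha]
    exact (h a (Finset.mem_insert_self a s)).add
      (ih fun i hi => h i (Finset.mem_insert_of_mem hi))

theorem two_pow (hf : IsKExponential k f) : IsKExponential (k + 1) fun n => 2 ^ f n := by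
  obtain ⟨p, hp⟩ := hf
  exact ⟨p, fun n => Nat.pow_le_pow_right (by norm_num) (hp n)⟩

theorem exists_le_two_pow (hf : IsKExponential k f) :
    ∃ g, IsKExponential (k - 1) g ∧ ∀ n, f n ≤ 2 ^ g n := by
  obtain ⟨p, hp⟩ := hf
  cases k with
  | zero => exact ⟨fun n => p.eval n, polynomial 0 p, fun n => (hp n).trans Nat.lt_two_pow_self.le⟩
  | succ k => exact ⟨fun n => tower k (p.eval n), ⟨p, fun _ => le_rfl⟩, hp⟩

/-- Writing `f n ≤ 2 ^ h n` turns the power into `2 ^ (h n * g n)`. An exponent thus costs one more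
level of height than a base. -/
theorem pow (hf : IsKExponential k f) (hg : IsKExponential l g) :
    IsKExponential (max k (l + 1)) fun n => f n ^ g n := by
  obtain ⟨h, hh, hle⟩ := hf.exists_le_two_pow
  have h1 : IsKExponential (max (k - 1) l) fun n => h n * g n :=
    (hh.mono_height (le_max_left _ _)).mul (hg.mono_height (le_max_right _ _))
  refine (h1.two_pow.mono_height (by omega)).mono fun n => ?_
  rw [pow_mul]
  exact Nat.pow_le_pow_left (hle n) _

end IsKExponential

/-! ### Growth of the recursion for the number of nulls -/

/-- The recursion that bounds the number of nulls of bounded depth in a component with `M` vertices,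
for `K - 1` external terms, `F` frontier variables and confluence `c`. -/
def levelBound (M K F c : ℕ) : ℕ → ℕ
  | 0 => 0
  | d + 1 => M * ((K + levelBound M K F c d) ^ c * K ^ F)

theorem levelBound_zero_le (M K F d : ℕ) : levelBound M K F 0 d ≤ M * K ^ F := by
  cases d <;> simp [levelBound]

/-- With `K` added, the recursion for confluence 1 grows by at most the factor `M * K ^ F + 1` per
level. -/
theorem levelBound_one_le (M K F d : ℕ) :
    K + levelBound M K F 1 d ≤ (M * K ^ F + 1) ^ d * K := by
  induction d with
  | zero => simp [levelBound]
  | succ d ih =>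
    calc K + levelBound M K F 1 (d + 1)
        ≤ (M * K ^ F + 1) * (K + levelBound M K F 1 d) := by simp only [levelBound]; nlinarith
      _ ≤ (M * K ^ F + 1) * ((M * K ^ F + 1) ^ d * K) := Nat.mul_le_mul_left _ ih
      _ = _ := by ring

/-- With base `K + M * K ^ F`, each level turns an exponent `y` into `1 + c * y`, which is at most
`(c + 1) * y`. The exponent is thus exponential in the depth, and the bound doubly exponential. -/
theorem levelBound_le (M F c d : ℕ) {K : ℕ} (hK : 0 < K) :
    K + levelBound M K F c d ≤ (K + M * K ^ F) ^ ((c + 1) ^ (d + 1)) := by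
  have hA : 0 < K + M * K ^ F := by omega
  induction d with
  | zero =>
    simp only [levelBound, add_zero]
    calc K ≤ K + M * K ^ F := Nat.le_add_right _ _
      _ = (K + M * K ^ F) ^ 1 := (pow_one _).symm
      _ ≤ _ := Nat.pow_le_pow_right hA (Nat.one_le_pow _ _ (by omega))
  | succ d ih =>
    set y := (c + 1) ^ (d + 1) with hy
    have hy1 : 1 ≤ y := Nat.one_le_pow _ _ (by omega)
    set Z := (K + levelBound M K F c d) ^ c with hZ
    have hZ1 : 1 ≤ Z := Nat.one_le_pow _ _ (by omega)
    calc K + levelBound M K F c (d + 1) = K * 1 + M * K ^ F * Z := by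
          simp only [levelBound, hZ]; ring
      _ ≤ K * Z + M * K ^ F * Z := Nat.add_le_add_right (Nat.mul_le_mul_left _ hZ1) _
      _ = (K + M * K ^ F) * Z := by ring
      _ ≤ (K + M * K ^ F) * ((K + M * K ^ F) ^ y) ^ c :=
          Nat.mul_le_mul_left _ (Nat.pow_le_pow_left ih c)
      _ = (K + M * K ^ F) ^ (1 + y * c) := by rw [← pow_mul, pow_add, pow_one]
      _ ≤ (K + M * K ^ F) ^ ((c + 1) ^ (d + 1 + 1)) := by
          refine Nat.pow_le_pow_right hA ?_
          rw [pow_succ, ← hy]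
          nlinarith

/-- The growth of `levelBound`, for `K` and `d` bounded by exponential functions. -/
theorem exists_isKExponential_levelBound (M F c : ℕ) {rin rcxt : ℕ} {k d : ℕ → ℕ}
    (hk : IsKExponential rin k) (hd : IsKExponential rcxt d) :
    ∃ f, IsKExponential (rankStep c rin rcxt) f ∧
      ∀ n K e, 0 < K → K ≤ k n → e ≤ d n → levelBound M K F c e ≤ f n := by
  match c with
  | 0 =>
    refine ⟨fun n => M * k n ^ F, (IsKExponential.const _ M).mul (hk.pow_const F), ?_⟩
    intro n K e _ hKn _
    exact (levelBound_zero_le M K F e).trans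
      (Nat.mul_le_mul_left _ (Nat.pow_le_pow_left hKn F))
  | 1 =>
    have hA : IsKExponential rin fun n => M * k n ^ F + 1 :=
      ((IsKExponential.const _ M).mul (hk.pow_const F)).add (IsKExponential.const _ 1)
    refine ⟨fun n => (M * k n ^ F + 1) ^ d n * k n,
      (hA.pow hd).mul (hk.mono_height (le_max_left _ _)), ?_⟩
    intro n K e _ hKn hen
    refine (Nat.le_add_left _ K).trans ((levelBound_one_le M K F e).trans ?_)
    calc (M * K ^ F + 1) ^ e * K ≤ (M * k n ^ F + 1) ^ e * k n := by gcongr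
      _ ≤ _ := Nat.mul_le_mul_right _ (Nat.pow_le_pow_right (by omega) hen)
  | c + 2 =>
    have hA : IsKExponential rin fun n => k n + M * k n ^ F :=
      hk.add ((IsKExponential.const _ M).mul (hk.pow_const F))
    have hB : IsKExponential (rcxt + 1) fun n => (c + 2 + 1) ^ (d n + 1) :=
      ((IsKExponential.const 0 (c + 2 + 1)).pow (hd.add (IsKExponential.const _ 1))).mono_height
        (by omega)
    refine ⟨fun n => (k n + M * k n ^ F) ^ ((c + 2 + 1) ^ (d n + 1)), hA.pow hB, ?_⟩
    intro n K e hK hKn hen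
    refine (Nat.le_add_left _ K).trans ((levelBound_le M F (c + 2) e hK).trans ?_)
    calc (K + M * K ^ F) ^ ((c + 2 + 1) ^ (e + 1))
        ≤ (k n + M * k n ^ F) ^ ((c + 2 + 1) ^ (e + 1)) := by gcongr
      _ ≤ _ := Nat.pow_le_pow_right (by omega) (Nat.pow_le_pow_right (by omega) (by omega))

section Graph
variable {S : Signature} {T : TGDSet S}

/-- The labels of the edges into `v` from its component. -/
def innerLabels (T : TGDSet S) (v : S.Var) : Set S.Var := {x | ∃ u ∈ scc T v, IsEdge T ⟨u, x, v⟩}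

theorem innerLabels_subset (T : TGDSet S) (v : S.Var) : innerLabels T v ⊆ frontierVars T := by
  rintro x ⟨u, -, -, r, hr, -, hx, -⟩
  exact ⟨r, hr, hx⟩

theorem finite_of_mem_sccs {C : Set S.Var} (hC : C ∈ sccs T) : C.Finite :=
  (finite_exVars T).subset (subset_exVars_of_mem_sccs hC)

theorem ncard_innerLabels_le {C : Set S.Var} (hC : C ∈ sccs T) {v : S.Var} (hv : v ∈ C) :
    (innerLabels T v).ncard ≤ confluenceOf T C := by
  refine le_csSup (Set.Finite.bddAbove ?_) ⟨v, hv, rfl⟩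
  refine ((finite_of_mem_sccs hC).image (confluence T)).subset ?_
  rintro k ⟨w, hw, rfl⟩
  exact ⟨w, hw, rfl⟩

end Graph

/-! ### Length of chains -/

namespace ChaseSequence
variable {S : Signature} {T : TGDSet S} {D : Database S}

open Classical in
/-- The values in step `i` of those frontier variables that belong to `A`. -/
noncomputable def profile (ch : ChaseSequence T D) (i : ℕ) (A : Set S.Var) :
    (finite_frontierVars T).toFinset → Option (GTerm S) :=
  fun x => if (x : S.Var) ∈ A then some (ch.sub i x) else none

theorem sub_eq_of_profile_eq {ch : ChaseSequence T D} {i j : ℕ} {A : Set S.Var}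
    (h : ch.profile i A = ch.profile j A) {x : S.Var} (hx : x ∈ frontierVars T) (hA : x ∈ A) :
    ch.sub i x = ch.sub j x := by
  have := congrFun h ⟨x, (finite_frontierVars T).mem_toFinset.2 hx⟩
  simpa [profile, hA] using this

theorem card_frontierVars (T : TGDSet S) :
    Fintype.card (finite_frontierVars T).toFinset = (frontierVars T).ncard := by
  rw [Fintype.card_coe, Set.ncard_eq_toFinset_card _ (finite_frontierVars T)]

namespace NullChain
variable {ch : ChaseSequence T D} {C : Set S.Var} {K : ℕ} {E : Set (Edge S)}

open Classical in
/-- The last edge in `E` before the null `nul j` of a chain. -/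
noncomputable def lastEdge (c : ch.NullChain C K) (E : Set (Edge S)) : ℕ → Option ℕ
  | 0 => none
  | j + 1 => if c.edge j ∈ E then some j else c.lastEdge E j

theorem notMem_of_lastEdge_eq_none (c : ch.NullChain C K) {j : ℕ} (h : c.lastEdge E j = none) :
    ∀ i < j, c.edge i ∉ E := by
  induction j with
  | zero => simp
  | succ j ih =>
    rw [lastEdge] at h
    split_ifs at h with hj
    intro i hi
    rcases Nat.lt_succ_iff_lt_or_eq.1 hi with hi | rfl
    · exact ih h i hi
    · exact hj

theorem of_lastEdge_eq_some (c : ch.NullChain C K) {j l : ℕ} (h : c.lastEdge E j = some l) :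
    l < j ∧ c.edge l ∈ E ∧ ∀ i, l < i → i < j → c.edge i ∉ E := by
  induction j with
  | zero => simp [lastEdge] at h
  | succ j ih =>
    rw [lastEdge] at h
    split_ifs at h with hj
    · obtain rfl : j = l := by simpa using h
      exact ⟨Nat.lt_succ_self j, hj, fun i h1 h2 => by omega⟩
    · obtain ⟨h1, h2, h3⟩ := ih h
      refine ⟨h1.trans (Nat.lt_succ_self j), h2, fun i hi hi' => ?_⟩
      rcases Nat.lt_succ_iff_lt_or_eq.1 hi' with hi' | rfl
      · exact h3 i hi hi'
      · exact hj

/-- The number of nulls in a chain is bounded in terms of the number of context terms. -/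
theorem length_le (hT : RenamedApart T) (hC : C ∈ sccs T) (hE : IsSaturating T C E)
    (c : ch.NullChain C K) (X : Finset (GTerm S))
    (hX : ∀ j < K, c.edge j ∈ E → ∀ x ∈ (ch.rule (c.step (j + 1))).frontier, x ≠ c.lbl j →
      ch.sub (c.step (j + 1)) x ∈ X) :
    K + 1 ≤ (E.ncard * (X.card + 1) ^ (frontierVars T).ncard + 1) * C.ncard := by
  classical
  have hEfin : E.Finite := (finite_isEdge T).subset fun e he => (hE.edges he).1
  have hCfin := finite_of_mem_sccs hC
  let ctx : ℕ → Edge S × ((finite_frontierVars T).toFinset → Option (GTerm S)) := fun l =>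
    (c.edge l, ch.profile (c.step (l + 1))
      {x | x ∈ (tgdOf T (c.edge l).tgt).frontier ∧ x ≠ (c.edge l).lbl})
  let P : Finset (Edge S × ((finite_frontierVars T).toFinset → Option (GTerm S))) :=
    hEfin.toFinset ×ˢ Fintype.piFinset fun _ => X.insertNone
  -- Each position of the chain is labelled by its last edge in `E` with context, and its variable.
  -- Equal labels at two positions mean either a repeated edge with the same context, or the same
  -- last edge and hence a cycle without edges of `E`. The summand 1 in the bound is for positions
  -- before the first edge in `E`.
  let label : ℕ → Option (Edge S × ((finite_frontierVars T).toFinset → Option (GTerm S))) × S.Var :=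
    fun j => ((c.lastEdge E j).map ctx, c.var j)
  have hctx : ∀ l < K, c.edge l ∈ E → ctx l ∈ P := by
    intro l hl he
    refine Finset.mem_product.2 ⟨hEfin.mem_toFinset.2 he, Fintype.mem_piFinset.2 fun x => ?_⟩
    by_cases hx : (x : S.Var) ∈ {x | x ∈ (tgdOf T (c.edge l).tgt).frontier ∧ x ≠ (c.edge l).lbl}
    · simp only [ctx, profile, if_pos hx]
      refine Finset.some_mem_insertNone.2 (hX l hl he x ?_ hx.2)
      rw [← (c.creates (l + 1) hl).tgdOf_eq hT]
      exact hx.1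
    · simp only [ctx, profile, if_neg hx]
      exact Finset.none_mem_insertNone
  have hcard : (P.insertNone ×ˢ hCfin.toFinset).card =
      (E.ncard * (X.card + 1) ^ (frontierVars T).ncard + 1) * C.ncard := by
    rw [Finset.card_product, Finset.card_insertNone, Finset.card_product,
      Fintype.card_piFinset, Finset.prod_const, Finset.card_univ, Finset.card_insertNone,
      card_frontierVars, ← Set.ncard_eq_toFinset_card _ hEfin,
      ← Set.ncard_eq_toFinset_card _ hCfin]
  rw [← hcard, ← Finset.card_range (K + 1)]
  refine Finset.card_le_card_of_injOn label ?_ ?_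
  · intro j hj
    have hj : j ≤ K := by simpa [Nat.lt_succ_iff] using hj
    refine Finset.mem_product.2 ⟨?_, hCfin.mem_toFinset.2 (c.mem j hj)⟩
    change (c.lastEdge E j).map ctx ∈ _
    cases hl : c.lastEdge E j with
    | none => exact Finset.none_mem_insertNone
    | some l =>
      obtain ⟨h1, h2, -⟩ := c.of_lastEdge_eq_some hl
      exact Finset.some_mem_insertNone.2 (hctx l (by omega) h2)
  · have key : ∀ i j, i < j → j ≤ K → label i ≠ label j := by
      intro i j hij hj h
      have hvar : c.var i = c.var j := congrArg Prod.snd h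
      have hopt : (c.lastEdge E i).map ctx = (c.lastEdge E j).map ctx := congrArg Prod.fst h
      have hloop : (∀ l, i ≤ l → l < j → c.edge l ∉ E) → False := by
        intro hno
        have := c.isPath_segment hT hij.le hj hno
        rw [← hvar] at this
        have := congrArg List.length (hE.acyclic _ _ this)
        rw [length_segment] at this
        simp at this
        omega
      have hrep : ∀ l l', l < l' → l' < K → c.edge l ∈ E → ctx l = ctx l' → False := by
        intro l l' hl hl' he hc
        have hedge : c.edge l = c.edge l' := congrArg Prod.fst hc
        have hprof := congrArg Prod.snd hc
        simp only [ctx] at hprof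
        rw [← hedge] at hprof
        refine c.not_repeated hT hE hl hl' he hedge fun x hx hne =>
          sub_eq_of_profile_eq hprof ⟨_, (c.creates (l + 1) (by omega)).rule_mem, ?_⟩ ⟨hx, hne⟩
        rwa [← (c.creates (l + 1) (by omega)).tgdOf_eq hT]
      cases hi' : c.lastEdge E i with
      | none =>
        rw [hi'] at hopt
        have hj' : c.lastEdge E j = none := by simpa using hopt.symm
        exact hloop fun l _ hl => c.notMem_of_lastEdge_eq_none hj' l hl
      | some l =>
        cases hj' : c.lastEdge E j with
        | none => simp [hi', hj'] at hopt
        | some l' =>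
          have hc : ctx l = ctx l' := by
            rw [hi', hj'] at hopt
            exact Option.some.inj hopt
          obtain ⟨h1, h2, -⟩ := c.of_lastEdge_eq_some hi'
          obtain ⟨h1', h2', h3'⟩ := c.of_lastEdge_eq_some hj'
          rcases lt_trichotomy l l' with hl | rfl | hl
          · exact hrep l l' hl (by omega) h2 hc
          · exact hloop fun m hm hm' => h3' m (by omega) hm'
          · exact hrep l' l hl (by omega) h2' hc.symm
    intro i hi j hj h
    have hi : i ≤ K := by simpa [Nat.lt_succ_iff] using hi
    have hj : j ≤ K := by simpa [Nat.lt_succ_iff] using hj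
    rcases lt_trichotomy i j with hij | hij | hij
    · exact absurd h (key i j hij hj)
    · exact hij
    · exact absurd h.symm (key j i hij hi)

/-- A chain that consists of a single null. -/
def single {i : ℕ} {v : S.Var} {n : S.Null} (h : ch.Creates i v n) (hv : v ∈ C) :
    ch.NullChain C 0 where
  nul _ := n
  var _ := v
  step _ := i
  lbl _ := v
  creates _ _ := h
  mem _ _ := hv
  lbl_mem _ hj := absurd hj (Nat.not_lt_zero _)
  sub_lbl _ hj := absurd hj (Nat.not_lt_zero _)

/-- Extension of a chain by a further null. -/
def snoc (c : ch.NullChain C K) {i : ℕ} {v x : S.Var} {n : S.Null} (h : ch.Creates i v n)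
    (hv : v ∈ C) (hx : x ∈ (ch.rule i).frontier) (hs : ch.sub i x = GTerm.null (c.nul K)) :
    ch.NullChain C (K + 1) where
  nul j := if j ≤ K then c.nul j else n
  var j := if j ≤ K then c.var j else v
  step j := if j ≤ K then c.step j else i
  lbl j := if j < K then c.lbl j else x
  creates j hj := by
    split_ifs with hjK
    · exact c.creates j hjK
    · exact h
  mem j hj := by
    split_ifs with hjK
    · exact c.mem j hjK
    · exact hv
  lbl_mem j hj := by
    by_cases hjK : j < K
    · rw [if_pos hjK, if_pos (Nat.succ_le_of_lt hjK)]
      exact c.lbl_mem j hjK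
    · rw [if_neg hjK, if_neg (by omega)]
      exact hx
  sub_lbl j hj := by
    by_cases hjK : j < K
    · rw [if_pos hjK, if_pos (Nat.succ_le_of_lt hjK), if_pos hjK.le]
      exact c.sub_lbl j hjK
    · obtain rfl : j = K := by omega
      rw [if_neg hjK, if_neg (by omega), if_pos le_rfl]
      exact hs

end NullChain

/-! ### Counting nulls by depth -/

/-- The nulls for the variables in `C`. -/
def nullsIn (ch : ChaseSequence T D) (C : Set S.Var) : Set S.Null :=
  {n | ∃ v ∈ C, ∃ i, ch.Creates i v n}

/-- The nulls for variables in `C` that are not the end of a chain of `d + 1` nulls. -/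
def level (ch : ChaseSequence T D) (C : Set S.Var) : ℕ → Set S.Null
  | 0 => ∅
  | d + 1 => {n | ∃ v ∈ C, ∃ i, ch.Creates i v n ∧ ∀ x ∈ (ch.rule i).frontier, ∀ m ∈ ch.nullsIn C,
      ch.sub i x = GTerm.null m → m ∈ ch.level C d}

variable {ch : ChaseSequence T D} {C : Set S.Var}

theorem exists_nullChain {n : S.Null} (hn : n ∈ ch.nullsIn C) {d : ℕ} (h : n ∉ ch.level C d) :
    ∃ c : ch.NullChain C d, c.nul d = n := by
  induction d generalizing n with
  | zero =>
    obtain ⟨v, hv, i, hi⟩ := hn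
    exact ⟨NullChain.single hi hv, rfl⟩
  | succ d ih =>
    obtain ⟨v, hv, i, hi⟩ := hn
    have : ∃ x ∈ (ch.rule i).frontier, ∃ m ∈ ch.nullsIn C, ch.sub i x = GTerm.null m ∧
        m ∉ ch.level C d := by
      by_contra! hcon
      exact h ⟨v, hv, i, hi, hcon⟩
    obtain ⟨x, hx, m, hm, hs, hml⟩ := this
    obtain ⟨c, rfl⟩ := ih hm hml
    exact ⟨c.snoc hi hv hx hs, by simp [NullChain.snoc]⟩

open Classical in
/-- The step in which a null is introduced. -/
noncomputable def creationStep (ch : ChaseSequence T D) (n : S.Null) : ℕ :=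
  if h : ∃ i v, ch.Creates i v n then h.choose else 0

theorem Creates.creationStep_eq {i : ℕ} {v : S.Var} {n : S.Null} (h : ch.Creates i v n) :
    ch.creationStep n = i := by
  have hex : ∃ i v, ch.Creates i v n := ⟨i, v, h⟩
  rw [creationStep, dif_pos hex]
  obtain ⟨w, hw⟩ := hex.choose_spec
  exact hw.step_unique h

theorem level_succ_bound (hT : RenamedApart T) (hC : C ∈ sccs T) (X : Finset (GTerm S))
    (hX : ∀ i v n, ch.Creates i v n → v ∈ C → ∀ x ∈ (ch.rule i).frontier, ch.sub i x ∈ X ∨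
      x ∈ innerLabels T v ∧ ∃ m ∈ ch.nullsIn C, ch.sub i x = GTerm.null m)
    {d N : ℕ} (hfin : (ch.level C d).Finite) (hN : (ch.level C d).ncard ≤ N) :
    (ch.level C (d + 1)).Finite ∧ (ch.level C (d + 1)).ncard ≤ C.ncard *
      ((X.card + 1 + N) ^ confluenceOf T C * (X.card + 1) ^ (frontierVars T).ncard) := by
  classical
  have hCfin := finite_of_mem_sccs hC
  let L : Finset (GTerm S) := hfin.toFinset.image GTerm.null
  have hL : L.card ≤ N := by
    refine Finset.card_image_le.trans ?_
    rwa [← Set.ncard_eq_toFinset_card _ hfin]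
  let A : S.Var → Set S.Null := fun v => {n | ∃ i, ch.Creates i v n ∧
    ∀ x ∈ (ch.rule i).frontier, ∀ m ∈ ch.nullsIn C, ch.sub i x = GTerm.null m → m ∈ ch.level C d}
  let V : S.Var → Finset ((finite_frontierVars T).toFinset → Option (GTerm S)) := fun v =>
    Fintype.piFinset fun x => if (x : S.Var) ∈ innerLabels T v then (X ∪ L).insertNone
      else X.insertNone
  have hV : ∀ v ∈ C, (V v).card ≤
      (X.card + 1 + N) ^ confluenceOf T C * (X.card + 1) ^ (frontierVars T).ncard := by
    intro v hv
    rw [Fintype.card_piFinset]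
    calc ∏ x : (finite_frontierVars T).toFinset,
          (if (x : S.Var) ∈ innerLabels T v then (X ∪ L).insertNone else X.insertNone).card
        ≤ ∏ x : (finite_frontierVars T).toFinset,
          -- The generous factor `X.card + 1` at inner labels lets the product split into a power
          -- counting the inner labels and a power counting all frontier variables.
          ((if (x : S.Var) ∈ innerLabels T v then X.card + 1 + N else 1) * (X.card + 1)) := by
          refine Finset.prod_le_prod' fun x _ => ?_
          split_ifs
          · rw [Finset.card_insertNone]
            have := Finset.card_union_le X L
            nlinarith
          · rw [Finset.card_insertNone, one_mul]
      _ = (X.card + 1 + N) ^ (Finset.univ.filter fun x : (finite_frontierVars T).toFinset =>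
            (x : S.Var) ∈ innerLabels T v).card * (X.card + 1) ^ (frontierVars T).ncard := by
          rw [Finset.prod_mul_distrib, ← Finset.prod_filter, Finset.prod_const, Finset.prod_const,
            Finset.card_univ, card_frontierVars]
      _ ≤ _ := by
          refine Nat.mul_le_mul_right _ (Nat.pow_le_pow_right (by omega) ?_)
          refine le_trans ?_ (ncard_innerLabels_le hC hv)
          rw [← Set.ncard_coe_finset]
          refine Set.ncard_le_ncard_of_injOn (fun x => (x : S.Var)) ?_
            (fun x _ y _ h => Subtype.ext h) ((finite_frontierVars T).subset (innerLabels_subset T v))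
          intro x hx
          simpa using hx
  let f : S.Var → S.Null → ((finite_frontierVars T).toFinset → Option (GTerm S)) := fun v n =>
    ch.profile (ch.creationStep n) (tgdOf T v).frontier
  have hmaps : ∀ v ∈ C, ∀ n ∈ A v, f v n ∈ (V v : Set _) := by
    rintro v hv n ⟨i, hi, hlev⟩
    refine Finset.mem_coe.2 (Fintype.mem_piFinset.2 fun x => ?_)
    simp only [f, hi.creationStep_eq, profile, hi.tgdOf_eq hT]
    by_cases hx : (x : S.Var) ∈ (ch.rule i).frontier
    · rw [if_pos hx]
      rcases hX i v n hi hv x hx with h | ⟨h, m, hm, hs⟩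
      · split_ifs
        · exact Finset.some_mem_insertNone.2 (Finset.mem_union_left _ h)
        · exact Finset.some_mem_insertNone.2 h
      · rw [if_pos h, hs]
        refine Finset.some_mem_insertNone.2 (Finset.mem_union_right _ ?_)
        exact Finset.mem_image_of_mem _ (hfin.mem_toFinset.2 (hlev x hx m hm hs))
    · rw [if_neg hx]
      split_ifs <;> exact Finset.none_mem_insertNone
  have hinj : ∀ v, Set.InjOn (f v) (A v) := by
    rintro v m ⟨i, hi, -⟩ n ⟨j, hj, -⟩ h
    simp only [f, hi.creationStep_eq, hj.creationStep_eq] at h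
    refine hi.eq_of_frontier_eq hT hj fun x hx => sub_eq_of_profile_eq h ⟨_, hi.rule_mem, ?_⟩ hx
    rwa [← hi.tgdOf_eq hT]
  have hA : ∀ v ∈ C, (A v).Finite ∧ (A v).ncard ≤
      (X.card + 1 + N) ^ confluenceOf T C * (X.card + 1) ^ (frontierVars T).ncard := by
    intro v hv
    refine ⟨Set.Finite.of_injOn (hmaps v hv) (hinj v) (V v).finite_toSet, ?_⟩
    refine le_trans ?_ (hV v hv)
    rw [← Set.ncard_coe_finset]
    exact Set.ncard_le_ncard_of_injOn (f v) (hmaps v hv) (hinj v) (V v).finite_toSet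
  have hlevel : ch.level C (d + 1) = ⋃ v ∈ C, A v := by
    ext n
    simp [level, A]
  have hfin' : (ch.level C (d + 1)).Finite := by
    rw [hlevel]
    exact hCfin.biUnion fun v hv => (hA v hv).1
  refine ⟨hfin', ?_⟩
  let U : Finset S.Null := hCfin.toFinset.attach.biUnion fun v =>
    (hA v (hCfin.mem_toFinset.1 v.2)).1.toFinset
  have hU : ch.level C (d + 1) ⊆ U := by
    intro n hn
    rw [hlevel] at hn
    simp only [Set.mem_iUnion] at hn
    obtain ⟨v, hv, hn⟩ := hn
    exact Finset.mem_coe.2 (Finset.mem_biUnion.2 ⟨⟨v, hCfin.mem_toFinset.2 hv⟩,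
      Finset.mem_attach _ _, (Set.Finite.mem_toFinset _).2 hn⟩)
  refine (Set.ncard_le_ncard hU U.finite_toSet).trans ?_
  rw [Set.ncard_coe_finset, Set.ncard_eq_toFinset_card _ hCfin,
    ← Finset.card_attach (s := hCfin.toFinset)]
  refine Finset.card_biUnion_le_card_mul _ _ _ fun v _ => ?_
  rw [← Set.ncard_eq_toFinset_card _ (hA v (hCfin.mem_toFinset.1 v.2)).1]
  exact (hA v (hCfin.mem_toFinset.1 v.2)).2

/-- A bound on the number of nulls of a component, in terms of the number of external terms and of
context terms. -/
theorem nullsIn_bound (hT : RenamedApart T) (hC : C ∈ sccs T) {E : Set (Edge S)}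
    (hE : IsSaturating T C E) (X Y : Finset (GTerm S))
    (hX : ∀ i v n, ch.Creates i v n → v ∈ C → ∀ x ∈ (ch.rule i).frontier, ch.sub i x ∈ X ∨
      x ∈ innerLabels T v ∧ ∃ m ∈ ch.nullsIn C, ch.sub i x = GTerm.null m)
    (hY : ∀ i v n, ch.Creates i v n → ∀ w y, (⟨w, y, v⟩ : Edge S) ∈ E →
      ∀ x ∈ (ch.rule i).frontier, x ≠ y → ch.sub i x ∈ Y) :
    (ch.nullsIn C).Finite ∧ (ch.nullsIn C).ncard ≤
      levelBound C.ncard (X.card + 1) (frontierVars T).ncard (confluenceOf T C)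
        ((E.ncard * (Y.card + 1) ^ (frontierVars T).ncard + 1) * C.ncard) := by
  set B := (E.ncard * (Y.card + 1) ^ (frontierVars T).ncard + 1) * C.ncard with hB
  have hlev : ∀ d, (ch.level C d).Finite ∧ (ch.level C d).ncard ≤
      levelBound C.ncard (X.card + 1) (frontierVars T).ncard (confluenceOf T C) d := by
    intro d
    induction d with
    | zero => simp [level, levelBound]
    | succ d ih => exact level_succ_bound hT hC X hX ih.1 ih.2
  -- A null outside level `B` ends a chain of `B + 1` nulls, one more than `length_le` permits.
  have hsub : ch.nullsIn C ⊆ ch.level C B := by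
    intro n hn
    by_contra hnot
    obtain ⟨c, -⟩ := exists_nullChain hn hnot
    have := c.length_le hT hC hE Y fun j hj he x hx hne =>
      hY _ _ _ (c.creates (j + 1) hj) _ _ he x hx hne
    omega
  exact ⟨(hlev B).1.subset hsub, (Set.ncard_le_ncard hsub (hlev B).1).trans (hlev B).2⟩

/-- The relevant constants together with the nulls of the components in `P`. -/
def termsOf (ch : ChaseSequence T D) (P : Set (Set S.Var)) : Set (GTerm S) :=
  GTerm.con '' relevantConstants T D ∪ GTerm.null '' ⋃ C ∈ P, ch.nullsIn C

theorem mem_termsOf (hT : RenamedApart T) {P : Set (Set S.Var)} {i : ℕ}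
    {v x : S.Var} {n : S.Null} (hn : ch.Creates i v n) (hx : x ∈ (ch.rule i).frontier)
    (hP : ∀ u ∈ exVars T, IsEdge T ⟨u, x, v⟩ → u ∉ C → scc T u ∈ P) :
    ch.sub i x ∈ ch.termsOf P ∨ ∃ u ∈ C, IsEdge T ⟨u, x, v⟩ ∧
      ∃ m ∈ ch.nullsIn C, ch.sub i x = GTerm.null m := by
  cases hs : ch.sub i x with
  | con c => exact Or.inl (Or.inl ⟨c, sub_mem_relevantConstants hn.lt_len hx hs, rfl⟩)
  | null m =>
    obtain ⟨j, u, hu⟩ := exists_creates_of_sub_eq hn.lt_len hx hs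
    have he := hu.isEdge hT hn hx hs
    by_cases huC : u ∈ C
    · exact Or.inr ⟨u, huC, he, m, ⟨u, huC, j, hu⟩, rfl⟩
    · refine Or.inl (Or.inr ⟨m, ?_, rfl⟩)
      simp only [Set.mem_iUnion]
      exact ⟨scc T u, hP u hu.exVars_mem he huC, u, mem_scc_self hu.exVars_mem, j, hu⟩

theorem termsOf_bound {P : Finset (Set S.Var)} {N : ℕ} {f : Set S.Var → ℕ}
    (hc : (relevantConstants T D).Finite ∧ (relevantConstants T D).ncard ≤ N)
    (hf : ∀ C ∈ P, (ch.nullsIn C).Finite ∧ (ch.nullsIn C).ncard ≤ f C) :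
    (ch.termsOf P).Finite ∧ (ch.termsOf P).ncard ≤ N + ∑ C ∈ P, f C := by
  classical
  have hU : (⋃ C ∈ (P : Set (Set S.Var)), ch.nullsIn C).Finite ∧
      (⋃ C ∈ (P : Set (Set S.Var)), ch.nullsIn C).ncard ≤ ∑ C ∈ P, f C := by
    induction P using Finset.induction_on with
    | empty => simp
    | insert C P hCP ih =>
      have ih := ih fun C' hC' => hf C' (Finset.mem_insert_of_mem hC')
      have h := hf C (Finset.mem_insert_self C P)
      rw [Finset.coe_insert, Set.biUnion_insert, Finset.sum_insert hCP]
      exact ⟨h.1.union ih.1, (Set.ncard_union_le _ _).trans (Nat.add_le_add h.2 ih.2)⟩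
  refine ⟨(hc.1.image _).union (hU.1.image _), (Set.ncard_union_le _ _).trans ?_⟩
  exact Nat.add_le_add ((Set.ncard_image_le hc.1).trans hc.2)
    ((Set.ncard_image_le hU.1).trans hU.2)

end ChaseSequence

/-! ### Induction along the order of the components -/

section Main
variable {S : Signature} {T : TGDSet S}

/-- The number of nulls of a component is bounded by an exponential function whose height is the rank
of the component. -/
theorem exists_component_bound (hT : RenamedApart T) {E : Set S.Var → Set (Edge S)}
    (hE : ∀ C ∈ sccs T, IsSaturating T C (E C))
    (hctx : ∀ C ∈ sccs T, C ∉ contextComponents T E C) (C : Set S.Var) (hC : C ∈ sccs T) :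
    ∃ f : ℕ → ℕ, IsKExponential (rank T E C) f ∧
      ∀ (D : Database S) (ch : ChaseSequence T D),
        (ch.nullsIn C).Finite ∧ (ch.nullsIn C).ncard ≤ f D.card := by
  classical
  induction C using (prec_wf T).induction with
  | _ C ih =>
  -- The bounds are made total, with value 0 off the predecessors of `C`, so that they can be
  -- summed.
  have ih' : ∀ C', ∃ f : ℕ → ℕ, Prec T C' C → IsKExponential (rank T E C') f ∧
      ∀ (D : Database S) (ch : ChaseSequence T D),
        (ch.nullsIn C').Finite ∧ (ch.nullsIn C').ncard ≤ f D.card := by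
    intro C'
    by_cases h : Prec T C' C
    · obtain ⟨f, hf⟩ := ih C' h h.1
      exact ⟨f, fun _ => hf⟩
    · exact ⟨fun _ => 0, fun h' => absurd h' h⟩
  choose f hf using ih'
  obtain ⟨p, hp⟩ := exists_bound_relevantConstants T
  have hPfin : {C' | Prec T C' C}.Finite := (finite_sccs T).subset fun C' h => h.1
  have hQfin : (contextComponents T E C).Finite := (finite_sccs T).subset fun C' h => h.1
  have hQP : ∀ C' ∈ contextComponents T E C, Prec T C' C := by
    intro C' hC'
    have hne : C' ≠ C := by rintro rfl; exact hctx _ hC hC'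
    obtain ⟨hs, v, hv, w, hw, u, hu, x, y, -, he, -⟩ := hC'
    exact ⟨hs, hC, hne, u, hu, v, hv, y, he⟩
  set rin := sSup {k | ∃ C', Prec T C' C ∧ k = rank T E C'}
  set rcxt := sSup {k | ∃ C' ∈ contextComponents T E C, k = rank T E C'}
  have hle_in : ∀ C', Prec T C' C → rank T E C' ≤ rin := by
    intro C' h
    refine le_csSup (Set.Finite.bddAbove ?_) ⟨C', h, rfl⟩
    refine (hPfin.image (rank T E)).subset ?_
    rintro k ⟨C', h, rfl⟩
    exact ⟨C', h, rfl⟩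
  have hle_cxt : ∀ C' ∈ contextComponents T E C, rank T E C' ≤ rcxt := by
    intro C' h
    refine le_csSup (Set.Finite.bddAbove ?_) ⟨C', h, rfl⟩
    refine (hQfin.image (rank T E)).subset ?_
    rintro k ⟨C', h, rfl⟩
    exact ⟨C', h, rfl⟩
  let k : ℕ → ℕ := fun n => p.eval n + ∑ C' ∈ hPfin.toFinset, f C' n + 1
  let y : ℕ → ℕ := fun n => p.eval n + ∑ C' ∈ hQfin.toFinset, f C' n
  let d : ℕ → ℕ := fun n =>
    ((E C).ncard * (y n + 1) ^ (frontierVars T).ncard + 1) * C.ncard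
  have hk : IsKExponential rin k := by
    refine ((IsKExponential.polynomial _ p).add (IsKExponential.sum _ fun C' h => ?_)).add
      (IsKExponential.const _ 1)
    have h := hPfin.mem_toFinset.1 h
    exact (hf C' h).1.mono_height (hle_in C' h)
  have hd : IsKExponential rcxt d := by
    have hy : IsKExponential rcxt y := by
      refine (IsKExponential.polynomial _ p).add (IsKExponential.sum _ fun C' h => ?_)
      have h := hQfin.mem_toFinset.1 h
      exact (hf C' (hQP C' h)).1.mono_height (hle_cxt C' h)
    exact (((IsKExponential.const _ _).mul ((hy.add (IsKExponential.const _ 1)).pow_const _)).add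
      (IsKExponential.const _ 1)).mul (IsKExponential.const _ _)
  obtain ⟨g, hg, hbound⟩ := exists_isKExponential_levelBound C.ncard (frontierVars T).ncard
    (confluenceOf T C) hk hd
  refine ⟨g, ?_, fun D ch => ?_⟩
  · rw [rank_eq T E C hC (hctx C hC)]
    exact hg
  · obtain ⟨hXfin, hXcard⟩ := ch.termsOf_bound (hp D) (P := hPfin.toFinset)
      (f := fun C' => f C' D.card) fun C' h => (hf C' (hPfin.mem_toFinset.1 h)).2 D ch
    obtain ⟨hYfin, hYcard⟩ := ch.termsOf_bound (hp D) (P := hQfin.toFinset)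
      (f := fun C' => f C' D.card) fun C' h => (hf C' (hQP C' (hQfin.mem_toFinset.1 h))).2 D ch
    have h := ch.nullsIn_bound hT hC (hE C hC) hXfin.toFinset hYfin.toFinset ?_ ?_
    · refine ⟨h.1, h.2.trans (hbound D.card _ _ (Nat.succ_pos _) ?_ ?_)⟩
      · rw [← Set.ncard_eq_toFinset_card _ hXfin]
        exact Nat.add_le_add_right hXcard 1
      · rw [← Set.ncard_eq_toFinset_card _ hYfin]
        exact Nat.mul_le_mul_right _ (Nat.add_le_add_right (Nat.mul_le_mul_left _
          (Nat.pow_le_pow_left (Nat.add_le_add_right hYcard 1) _)) 1)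
    · intro i v n hn hv x hx
      rw [Set.Finite.mem_toFinset]
      refine (ch.mem_termsOf (C := C) hT hn hx fun u hu he huC => ?_).imp_right ?_
      · rw [Set.Finite.coe_toFinset]
        refine ⟨⟨u, hu, rfl⟩, hC, ?_, u, mem_scc_self hu, v, hv, x, he⟩
        rintro rfl
        exact huC (mem_scc_self hu)
      · rintro ⟨u, hu, he, hm⟩
        exact ⟨⟨u, by rwa [← eq_scc_of_mem hC hv], he⟩, hm⟩
    · intro i v n hn w y he x hx hne
      rw [Set.Finite.mem_toFinset]
      have hedge := (hE C hC).edges he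
      have hctx' : ∀ u ∈ exVars T, IsEdge T ⟨u, x, v⟩ → scc T u ∈ contextComponents T E C :=
        fun u hu hu' => ⟨⟨u, hu, rfl⟩, v, hedge.2.2, w, hedge.2.1, u, mem_scc_self hu, y, x, he, hu',
          hne.symm⟩
      refine (ch.mem_termsOf (C := C) hT hn hx fun u hu hu' _ => ?_).resolve_right ?_
      · rw [Set.Finite.coe_toFinset]
        exact hctx' u hu hu'
      -- A context value that is a null of `C` would make `C` a context component of itself.
      · rintro ⟨u, hu, hu', -⟩
        have := hctx' u (subset_exVars_of_mem_sccs hC hu) hu'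
        rw [← eq_scc_of_mem hC hu] at this
        exact hctx C hC this

end Main
end Chase

theorem theorem5p5 (S : Signature) (T : Chase.TGDSet S) (hT : Chase.RenamedApart T)
    (E : Set S.Var → Set (Chase.Edge S))
    (hE : ∀ C ∈ Chase.sccs T, Chase.IsSaturating T C (E C))
    (hctx : ∀ C ∈ Chase.sccs T, C ∉ Chase.contextComponents T E C)
    (v : S.Var) (hv : v ∈ Chase.exVars T) :
    ∃ f : ℕ → ℕ, Chase.IsKExponential (Chase.rank T E (Chase.scc T v)) f ∧
      ∀ (D : Chase.Database S) (ch : Chase.ChaseSequence T D),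
        (ch.nullsOf v).Finite ∧ (ch.nullsOf v).ncard ≤ f D.card := by
  obtain ⟨f, hf, h⟩ := Chase.exists_component_bound hT hE hctx (Chase.scc T v) ⟨v, hv, rfl⟩
  refine ⟨f, hf, fun D ch => ?_⟩
  have hsub : ch.nullsOf v ⊆ ch.nullsIn (Chase.scc T v) :=
    fun n hn => ⟨v, Chase.mem_scc_self hv, hn⟩
  exact ⟨(h D ch).1.subset hsub, (Set.ncard_le_ncard hsub (h D ch).1).trans (h D ch).2⟩
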